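/- For an admissible sequence $\mathbf{k}=(k_1,\ldots,k_n)$ of positive integers ($k_1\ge 2$) let $\zeta(\mathbf{k})=\sum_{m_1>\cdots>m_n>0}m_1^{-k_1}\cdots m_n^{-k_n}$, and for $t\in\mathbb{C}$ let $\zeta^t(\mathbf{k})=\sum_{\mathbf{p}}t^{\,n-\mathrm{dep}(\mathbf{p})}\zeta(\mathbf{p})$, where $\mathbf{p}$ runs over all sequences $(k_1\Box k_2\Box\cdots\Box k_n)$ in which each $\Box$ is filled by a comma or a plus sign, and $\mathrm{dep}(\mathbf{p})$ is the number of entries of $\mathbf{p}$. Let $X_0(k,n,s)$ be the sum of $\zeta^t(\mathbf{k})$ over all admissible $\mathbf{k}$ of weight $k=k_1+\cdots+k_n$, depth $n$ and height $s=\#\{i: k_i\ge 2\}$, and let $$\Phi_0(u,v,w)=\sum_{k\ge n+s,\ n\ge s\ge 1}X_0(k,n,s)\,u^{k-n-s}v^{n-s}w^{2s-2}.$$ Let $t\in\mathbb{C}$. The series $\Phi_0(u,v,w)$ converges absolutely for all complex $u,v,w$ in some neighbourhood of $(0,0,0)$ (depending on $t$). Moreover, let $u,v,w\in\mathbb{C}$,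 and let $\alpha,\beta,\gamma_1,\gamma_2\in\mathbb{C}$ be determined by $$\alpha+\beta=u+vt,\quad \alpha\beta=t(uv-w^2),\qquad \gamma_1+\gamma_2=-u-(t-1)v,\quad \gamma_1\gamma_2=(t-1)(uv-w^2).$$ Assume that $\Re(\alpha)<1$, $\Re(\beta)<1$, $0<\Re(v)<1$ and $\alpha-\beta\notin\mathbb{Z}$. Then the two integrals below converge absolutely, and, if the series $\Phi_0(u,v,w)$ converges absolutely, $$\begin{aligned}\Phi_0(u,v,w)={}&\frac{\Gamma(\alpha-\beta)\Gamma(1-v)}{\Gamma(1-\gamma_1-\beta)\Gamma(1-\gamma_2-\beta)}\int_0^1z^{-\alpha}(1-z)^{v-1}F\left({\gamma_1+\beta,\ \gamma_2+\beta\atop \beta-\alpha+1};z\right)dz\\&+\frac{\Gamma(\beta-\alpha)\Gamma(1-v)}{\Gamma(1-\gamma_1-\alpha)\Gamma(1-\gamma_2-\alpha)}\int_0^1z^{-\beta}(1-z)^{v-1}F\left({\gamma_1+\alpha,\ \gamma_2+\alpha\atop \alpha-\beta+1};z\right)dz,\end{aligned}$$ where $F\left({a,b\atop c};z\right)=\sum_{n\ge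 0}\frac{(a)_n(b)_n}{n!\,(c)_n}z^n$ is the Gauss hypergeometric function and $1/\Gamma$ is read as $0$ at the poles of $\Gamma$. -/

import Mathlib

namespace InterpolatedMZV

noncomputable section

/-- The multiple zeta value `ζ(k₁, …, kₙ) = ∑_{m₁ > ⋯ > mₙ > 0} 1 / (m₁ ^ k₁ ⋯ mₙ ^ kₙ)`. -/
def mzv (ks : List ℕ) : ℝ :=
  ∑' m : {m : Fin ks.length → ℕ // StrictAnti m ∧ ∀ i, 0 < m i},
    ∏ i, 1 / (m.1 i : ℝ) ^ (ks.get i)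

/-- All sequences `(k □ k₂ □ ⋯ □ kₙ)`, each `□` being filled by a comma or by a plus;
the first argument is the (possibly already accumulated) first entry. -/
def fillingsAux : ℕ → List ℕ → List (List ℕ)
  | k, [] => [[k]]
  | k, l :: r => (fillingsAux l r).map (fun p => k :: p) ++ fillingsAux (k + l) r

/-- All sequences `(k₁ □ k₂ □ ⋯ □ kₙ)`, each `□` being filled by a comma or by a plus. -/
def fillings : List ℕ → List (List ℕ)
  | [] => [[]]
  | k :: r => fillingsAux k r

/-- The interpolated multiple zeta value `ζᵗ(k₁, …, kₙ) = ∑_p t ^ (n - dep p) ζ(p)`, where `p`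
runs over all the fillings of `(k₁ □ ⋯ □ kₙ)`. -/
def tMZV (t : ℂ) (ks : List ℕ) : ℂ :=
  ((fillings ks).map fun p => t ^ (ks.length - p.length) * (mzv p : ℂ)).sum

/-- The number of entries that are at least two. -/
def height (ks : List ℕ) : ℕ := ks.countP (fun k => 2 ≤ k)

/-- The set `I₀(k, n, s)` of the admissible indices (first entry at least two) of weight `k`,
depth `n` and height `s`. An index of weight `k` is a composition of `k`. -/
def admissibleIndices (k n s : ℕ) : Finset (Composition k) :=
  {c | 2 ≤ c.blocks.headD 0 ∧ c.length = n ∧ height c.blocks = s}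

/-- The sum `X₀(k, n, s)` of the interpolated multiple zeta values over `I₀(k, n, s)`. -/
def X₀ (t : ℂ) (k n s : ℕ) : ℂ :=
  ∑ c ∈ admissibleIndices k n s, tMZV t c.blocks

/-- The triples `(k, n, s)` with `k ≥ n + s` and `n ≥ s ≥ 1`. -/
abbrev Triples : Type :=
  {q : ℕ × ℕ × ℕ // q.2.1 + q.2.2 ≤ q.1 ∧ q.2.2 ≤ q.2.1 ∧ 1 ≤ q.2.2}

/-- The term `X₀(k, n, s) u ^ (k - n - s) v ^ (n - s) w ^ (2 s - 2)` of the generating function. -/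
def Φ₀Term (t u v w : ℂ) (q : Triples) : ℂ :=
  X₀ t q.1.1 q.1.2.1 q.1.2.2 *
    u ^ (q.1.1 - q.1.2.1 - q.1.2.2) * v ^ (q.1.2.1 - q.1.2.2) * w ^ (2 * q.1.2.2 - 2)

/-- The generating function `Φ₀(u, v, w)`, meaningful where the series converges absolutely. -/
def Φ₀ (t u v w : ℂ) : ℂ := ∑' q : Triples, Φ₀Term t u v w q

/-- The integrand `z ^ (-δ) (1 - z) ^ (v - 1) F(a, b; c; z)` on the real interval `(0, 1)`. -/
def eulerIntegrand (δ v a b c : ℂ) (z : ℝ) : ℂ :=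
  (z : ℂ) ^ (-δ) * (1 - (z : ℂ)) ^ (v - 1) * ₂F₁ a b c (z : ℂ)

end

end InterpolatedMZV

open Filter Topology Finset MeasureTheory

namespace InterpolatedMZV

/-! Near the origin. Fix the largest summation index m + 1. A comma in a filling makes the next
index strictly smaller, a plus makes it equal at the cost of a factor t (`sum_fillings_headPart`).
Summing over all remaining entries, weighted by u, v, w, gives a sequence E with E_m = 1 + ∑_{j<m}
a_j E_j + t a_m E_m, where a_j = v/(j+1) + w²/((j+1)(j+1-u)). This is a first-order linear
recursion, and 1 - t a_m and 1 + (1-t) a_m factor through α, β and γ₁, γ₂. So Φ₀ is the series ∑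
`prodTerm`, a quotient of rising factorials summed over m (`block_mul_genSum`,
`hasSum_Φ₀Term_prodTerm`). The comparison E_m ≤ 2√(m+1) justifies the rearrangements.

Other points of absolute convergence. Along the ray x ↦ (xu, xv, xw) both sides are analytic in x,
agree near 0 and are continuous up to x = 1 (`tsum_Φ₀Term_eq`).

The integrals. Expanding F and integrating termwise gives Γ(v) times `mellinSum` at M = 0. As a
function of M, each Mellin sum satisfies the same first-order difference equation up to a constant
inhomogeneity (`mellinSum_step`), and Gauss's theorem gives its decay as a constant times M^(-v)
(`tendsto_mellinSum`). In the combination T_M with the stated Gamma factors, the reflection formula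
normalises the inhomogeneity to 1 (`connection_const`) and cancels the leading asymptotics
(`connection_vanish`). Hence ∑ `prodTerm` telescopes to T_0 (`tsum_prodTerm_eq`). -/

/-! ### Multiple zeta values as iterated sums -/

lemma norm_natCast_add_one (m : ℕ) : ‖(m : ℂ) + 1‖ = (m : ℝ) + 1 := by
  rw [← Nat.cast_succ, Complex.norm_natCast]; push_cast; rfl

/-- The finite sum `∑_{N ≥ m₁ > ⋯ > mₙ > 0} m₁⁻ᵏ¹ ⋯ mₙ⁻ᵏⁿ`. -/
noncomputable def truncZeta : List ℕ → ℕ → ℝ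
  | [], _ => 1
  | k :: p, N => ∑ m ∈ range N, 1 / ((m : ℝ) + 1) ^ k * truncZeta p m

lemma truncZeta_nonneg (p : List ℕ) (N : ℕ) : 0 ≤ truncZeta p N := by
  induction p generalizing N with
  | nil => simp [truncZeta]
  | cons k p ih => exact sum_nonneg fun m _ => mul_nonneg (by positivity) (ih m)

lemma strictAnti_cons_iff {n : ℕ} (a : ℕ) (m : Fin n → ℕ) :
    StrictAnti (Fin.cons a m : Fin (n + 1) → ℕ) ↔ StrictAnti m ∧ ∀ i, m i < a := by
  constructor
  · intro h
    exact ⟨fun i j hij => by simpa using h (Fin.succ_lt_succ_iff.2 hij),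
      fun i => by simpa using h (Fin.succ_pos i)⟩
  · rintro ⟨h1, h2⟩ i j hij
    induction j using Fin.cases with
    | zero => exact absurd hij (Fin.not_lt_zero i)
    | succ j =>
      induction i using Fin.cases with
      | zero => simpa using h2 j
      | succ i => simpa using h1 (Fin.succ_lt_succ_iff.1 hij)

/-- The summand of a multiple zeta value. -/
noncomputable def chainTerm (p : List ℕ) (m : Fin p.length → ℕ) : ℝ :=
  ∏ i, 1 / (m i : ℝ) ^ (p.get i)

lemma chainTerm_nonneg (p : List ℕ) (m : Fin p.length → ℕ) : 0 ≤ chainTerm p m :=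
  prod_nonneg fun _ _ => by positivity

/-- Splits off the largest index. Working in `ENNReal` makes every rearrangement free of summability
conditions. The predicate `P` serves both uses: `· ≤ N` for truncated sums and `True` for the full
value. -/
lemma tsum_chain_cons (k : ℕ) (p : List ℕ) (P : ℕ → Prop) [DecidablePred P]
    (ih : ∀ N, ∑' m : Fin p.length → ℕ, (if StrictAnti m ∧ (∀ i, 0 < m i) ∧ ∀ i, m i ≤ N
      then ENNReal.ofReal (chainTerm p m) else 0) = ENNReal.ofReal (truncZeta p N)) :
    ∑' m : Fin (p.length + 1) → ℕ, (if StrictAnti m ∧ (∀ i, 0 < m i) ∧ P (m 0)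
      then ENNReal.ofReal (chainTerm (k :: p) m) else 0) =
    ∑' a : ℕ, (if P (a + 1) then
      ENNReal.ofReal (1 / ((a : ℝ) + 1) ^ k * truncZeta p a) else 0) := by
  have key : ∀ (a : ℕ) (m : Fin p.length → ℕ),
      (if StrictAnti (Fin.cons a m : Fin (p.length + 1) → ℕ) ∧
        (∀ i, 0 < (Fin.cons a m : Fin (p.length + 1) → ℕ) i) ∧
        P ((Fin.cons a m : Fin (p.length + 1) → ℕ) 0)
      then ENNReal.ofReal (chainTerm (k :: p) (Fin.cons a m : Fin (p.length + 1) → ℕ)) else 0) =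
      (if 0 < a ∧ P a then ENNReal.ofReal (1 / (a : ℝ) ^ k) else 0) *
      (if StrictAnti m ∧ (∀ i, 0 < m i) ∧ ∀ i, m i ≤ a - 1
      then ENNReal.ofReal (chainTerm p m) else 0) := by
    intro a m
    have h1 : chainTerm (k :: p) (Fin.cons a m : Fin (p.length + 1) → ℕ) =
        1 / (a : ℝ) ^ k * chainTerm p m := by
      rw [chainTerm]
      exact (Fin.prod_univ_succ (n := p.length) _).trans (by simp [chainTerm])
    have h2 : (StrictAnti (Fin.cons a m : Fin (p.length + 1) → ℕ) ∧
        (∀ i, 0 < (Fin.cons a m : Fin (p.length + 1) → ℕ) i) ∧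
        P ((Fin.cons a m : Fin (p.length + 1) → ℕ) 0)) ↔
        (StrictAnti m ∧ ∀ i, m i < a) ∧ (0 < a ∧ ∀ i, 0 < m i) ∧ P a := by
      rw [strictAnti_cons_iff, Fin.forall_fin_succ]
      simp only [Fin.cons_zero, Fin.cons_succ]
    rw [h1, ENNReal.ofReal_mul (by positivity)]
    by_cases ha : 0 < a ∧ P a
    · have : (∀ i, m i < a) ↔ ∀ i, m i ≤ a - 1 :=
        forall_congr' fun i => by have := ha.1; omega
      rw [this] at h2
      rw [if_pos ha]
      by_cases h : StrictAnti m ∧ (∀ i, 0 < m i) ∧ ∀ i, m i ≤ a - 1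
      · rw [if_pos h, if_pos (by tauto)]
      · rw [if_neg h, if_neg (by tauto), mul_zero]
    · rw [if_neg ha, if_neg (by tauto), zero_mul]
  rw [← (Fin.consEquiv (fun _ : Fin (p.length + 1) => ℕ)).tsum_eq, ENNReal.tsum_prod']
  refine (tsum_congr fun a => tsum_congr fun m => key a m).trans ?_
  simp_rw [ENNReal.tsum_mul_left, ih]
  -- The term a = 0 vanishes because indices are positive; dropping it shifts a to a + 1, and the
  -- bound a - 1 on the remaining indices becomes a.
  rw [tsum_eq_zero_add' ENNReal.summable]
  simp only [lt_irrefl, false_and, if_false, zero_mul, zero_add, Nat.add_sub_cancel,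
    Nat.succ_pos, true_and]
  refine tsum_congr fun a => ?_
  split_ifs
  · rw [← ENNReal.ofReal_mul (by positivity)]; push_cast; rfl
  · simp

lemma tsum_chain_eq_truncZeta (p : List ℕ) (N : ℕ) :
    ∑' m : Fin p.length → ℕ, (if StrictAnti m ∧ (∀ i, 0 < m i) ∧ ∀ i, m i ≤ N
      then ENNReal.ofReal (chainTerm p m) else 0) = ENNReal.ofReal (truncZeta p N) := by
  induction p generalizing N with
  | nil =>
    refine (tsum_eq_single (fun i : Fin 0 => i.elim0) fun m hm =>
      absurd (funext fun i : Fin 0 => i.elim0) hm).trans ?_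
    rw [if_pos ⟨fun i => i.elim0, fun i => i.elim0, fun i => i.elim0⟩]
    simp [chainTerm, truncZeta]
  | cons k p ih =>
    refine Eq.trans (tsum_congr fun m => ?_) ((tsum_chain_cons k p (· ≤ N) ih).trans ?_)
    · refine ite_congr (propext (and_congr_right fun h => and_congr_right fun _ => ?_))
        (fun _ => rfl) (fun _ => rfl)
      exact ⟨fun h => h _, fun h' i =>
        (h.antitone (Fin.zero_le (n := p.length + 1) i)).trans h'⟩
    · refine (tsum_eq_sum (s := range N) fun a ha =>
        if_neg (by simpa [Nat.succ_le_iff] using ha)).trans ?_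
      rw [truncZeta,
        ENNReal.ofReal_sum_of_nonneg fun m _ => mul_nonneg (by positivity) (truncZeta_nonneg p m)]
      exact sum_congr rfl fun a ha => if_pos (by simpa [Nat.succ_le_iff] using ha)

lemma mzv_cons (k : ℕ) (p : List ℕ) :
    mzv (k :: p) = ∑' m : ℕ, 1 / ((m : ℝ) + 1) ^ k * truncZeta p m := by
  classical
  have h := tsum_chain_cons k p (fun _ => True) (tsum_chain_eq_truncZeta p)
  simp only [and_true, if_true] at h
  have h1 : mzv (k :: p) = (∑' m : {m : Fin (k :: p).length → ℕ // StrictAnti m ∧ ∀ i, 0 < m i},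
      ENNReal.ofReal (chainTerm (k :: p) m.1)).toReal := by
    rw [ENNReal.tsum_toReal_eq fun _ => ENNReal.ofReal_ne_top]
    exact tsum_congr fun m => (ENNReal.toReal_ofReal (chainTerm_nonneg _ _)).symm
  rw [h1]
  have h2 := tsum_subtype {m : Fin (k :: p).length → ℕ | StrictAnti m ∧ ∀ i, 0 < m i}
    (fun m => ENNReal.ofReal (chainTerm (k :: p) m))
  refine (congrArg ENNReal.toReal (h2.trans (Eq.trans (tsum_congr fun m => ?_) h))).trans ?_
  · simp [Set.indicator_apply]
  · rw [ENNReal.tsum_toReal_eq fun _ => ENNReal.ofReal_ne_top]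
    exact tsum_congr fun m => ENNReal.toReal_ofReal
      (mul_nonneg (by positivity) (truncZeta_nonneg p m))

lemma sum_inv_sqrt_le (N : ℕ) :
    ∑ m ∈ range N, 1 / √((m : ℝ) + 1) ≤ 2 * √N := by
  induction N with
  | zero => simp
  | succ N ih =>
    rw [sum_range_succ]
    push_cast
    have h1 : 0 < √((N : ℝ) + 1) := Real.sqrt_pos.2 (by positivity)
    have h2 : √((N : ℝ) + 1) ^ 2 = N + 1 := Real.sq_sqrt (by positivity)
    have h3 : √(N : ℝ) ^ 2 = N := Real.sq_sqrt (by positivity)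
    have : 1 / √((N : ℝ) + 1) ≤ 2 * √((N : ℝ) + 1) - 2 * √N := by
      rw [div_le_iff₀ h1]
      nlinarith [sq_nonneg (√((N : ℝ) + 1) - √N)]
    linarith

/-- The true growth is a power of log N. The cruder square root is stable under the recursion and
still leaves the summable m^(-3/2) once the leading exponent is at least 2. -/
lemma truncZeta_le (p : List ℕ) (hp : ∀ k ∈ p, 1 ≤ k) (N : ℕ) :
    truncZeta p N ≤ 2 ^ p.length * √((N : ℝ) + 1) := by
  induction p generalizing N with
  | nil => simp [truncZeta]
  | cons k p ih =>
    have hk : 1 ≤ k := hp k (by simp)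
    calc truncZeta (k :: p) N
        ≤ ∑ m ∈ range N, 2 ^ p.length * (1 / √((m : ℝ) + 1)) := by
          refine sum_le_sum fun m _ => ?_
          have h0 : (0 : ℝ) < √((m : ℝ) + 1) := Real.sqrt_pos.2 (by positivity)
          have h2 : √((m : ℝ) + 1) ^ 2 = m + 1 := Real.sq_sqrt (by positivity)
          have h1 : 1 / ((m : ℝ) + 1) ^ k ≤ 1 / ((m : ℝ) + 1) :=
            one_div_le_one_div_of_le (by positivity) (le_self_pow₀ (by simp) (by omega))
          calc _ ≤ 1 / ((m : ℝ) + 1) * (2 ^ p.length * √((m : ℝ) + 1)) :=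
                mul_le_mul h1 (ih (fun k hk => hp k (by simp [hk])) m) (truncZeta_nonneg _ _)
                  (by positivity)
            _ = _ := by field_simp; rw [h2]
      _ ≤ 2 ^ p.length * (2 * √N) := by
          rw [← mul_sum]; gcongr; exact sum_inv_sqrt_le N
      _ ≤ 2 ^ (p.length + 1) * √((N : ℝ) + 1) := by
          rw [pow_succ, mul_assoc]; gcongr; linarith
      _ = _ := by simp

lemma summable_sqrt_div_sq : Summable fun m : ℕ => √((m : ℝ) + 1) / ((m : ℝ) + 1) ^ 2 := by
  have h := (summable_nat_add_iff 1).2 (Real.summable_nat_rpow_inv.2 (show (1 : ℝ) < 3 / 2 by norm_num))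
  refine h.congr fun m => ?_
  have : (0 : ℝ) < (m : ℝ) + 1 := by positivity
  rw [Real.sqrt_eq_rpow, ← Real.rpow_natCast, ← Real.rpow_sub this, ← Real.rpow_neg (by positivity)]
  push_cast
  norm_num

lemma hasSum_mzv_cons (k : ℕ) (hk : 2 ≤ k) (p : List ℕ) (hp : ∀ k ∈ p, 1 ≤ k) :
    HasSum (fun m : ℕ => 1 / ((m : ℝ) + 1) ^ k * truncZeta p m) (mzv (k :: p)) := by
  rw [mzv_cons]
  refine Summable.hasSum ?_
  refine Summable.of_nonneg_of_le (fun m => mul_nonneg (by positivity) (truncZeta_nonneg p m))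
    (fun m => ?_) (summable_sqrt_div_sq.mul_left (2 ^ p.length))
  have h1 : 1 / ((m : ℝ) + 1) ^ k ≤ 1 / ((m : ℝ) + 1) ^ 2 :=
    one_div_le_one_div_of_le (by positivity) (pow_le_pow_right₀ (by simp) hk)
  calc _ ≤ 1 / ((m : ℝ) + 1) ^ 2 * (2 ^ p.length * √((m : ℝ) + 1)) :=
        mul_le_mul h1 (truncZeta_le p hp m) (truncZeta_nonneg _ _) (by positivity)
    _ = _ := by ring

/-! ### Interpolated values: summing over the fillings -/

/-- The sum over the fillings of `(k □ r₁ □ ⋯)` of the `m₁ = m + 1` parts. -/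
noncomputable def fillWeight (t : ℂ) : List ℕ → ℕ → ℂ
  | [], _ => 1
  | l :: r, m => ∑ j ∈ range m, 1 / ((j : ℂ) + 1) ^ l * fillWeight t r j +
      t * (1 / ((m : ℂ) + 1) ^ l * fillWeight t r m)

/-- The part with `m₁ = m + 1` of `ζ(p)`. -/
noncomputable def headPart : List ℕ → ℕ → ℝ
  | [], _ => 0
  | k :: p, m => 1 / ((m : ℝ) + 1) ^ k * truncZeta p m

lemma length_le_of_mem_fillingsAux (r : List ℕ) (k : ℕ) :
    ∀ p ∈ fillingsAux k r, p ≠ [] ∧ p.length ≤ r.length + 1 := by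
  induction r generalizing k with
  | nil => simp [fillingsAux]
  | cons l r ih =>
    intro p hp
    simp only [fillingsAux, List.mem_append, List.mem_map] at hp
    rcases hp with ⟨q, hq, rfl⟩ | hp
    · have := (ih l q hq).2
      simp; omega
    · exact ⟨(ih _ p hp).1, by have := (ih _ p hp).2; simp; omega⟩

lemma entries_of_mem_fillingsAux (r : List ℕ) (hr : ∀ l ∈ r, 1 ≤ l) (k : ℕ) :
    ∀ p ∈ fillingsAux k r, ∃ h q, p = h :: q ∧ k ≤ h ∧ ∀ l ∈ q, 1 ≤ l := by
  induction r generalizing k with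
  | nil => simp [fillingsAux]
  | cons l r ih =>
    have hl : 1 ≤ l := hr l (by simp)
    have ih := ih fun l hl => hr l (by simp [hl])
    intro p hp
    simp only [fillingsAux, List.mem_append, List.mem_map] at hp
    rcases hp with ⟨q, hq, rfl⟩ | hp
    · obtain ⟨h, q', rfl, hh, hq'⟩ := ih l q hq
      refine ⟨k, _, rfl, le_rfl, fun x hx => ?_⟩
      rcases List.mem_cons.1 hx with rfl | hx
      · omega
      · exact hq' x hx
    · obtain ⟨h, q', rfl, hh, hq'⟩ := ih _ p hp
      exact ⟨h, q', rfl, by omega, hq'⟩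

/-- A plus merges k and l into the exponent k + l of the same index m + 1, one part fewer and so one
more factor t; a comma moves on to a smaller index j + 1. These are the two summands of
`fillWeight`. -/
lemma sum_fillings_headPart (t : ℂ) (r : List ℕ) (k m : ℕ) :
    ((fillingsAux k r).map fun p => t ^ (r.length + 1 - p.length) * (headPart p m : ℂ)).sum =
      1 / ((m : ℂ) + 1) ^ k * fillWeight t r m := by
  induction r generalizing k m with
  | nil => simp [fillingsAux, headPart, truncZeta, fillWeight]
  | cons l r ih =>
    have h1 : ∀ p ∈ fillingsAux l r, t ^ ((l :: r).length + 1 - (k :: p).length) *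
        (headPart (k :: p) m : ℂ) = 1 / ((m : ℂ) + 1) ^ k * ∑ j ∈ range m,
          t ^ (r.length + 1 - p.length) * (headPart p j : ℂ) := by
      intro p hp
      obtain ⟨hne, -⟩ := length_le_of_mem_fillingsAux r l p hp
      obtain ⟨h, q, rfl⟩ := List.exists_cons_of_ne_nil hne
      simp only [headPart, truncZeta, List.length_cons, Nat.add_sub_add_right]
      push_cast
      rw [← mul_sum]; ring
    have h2 : ∀ p ∈ fillingsAux (k + l) r, t ^ ((l :: r).length + 1 - p.length) *
        (headPart p m : ℂ) = t * (t ^ (r.length + 1 - p.length) * (headPart p m : ℂ)) := by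
      intro p hp
      obtain ⟨-, hle⟩ := length_le_of_mem_fillingsAux r _ p hp
      rw [List.length_cons, show r.length + 1 + 1 - p.length = r.length + 1 - p.length + 1 by omega,
        pow_succ]
      ring
    rw [fillingsAux, List.map_append, List.sum_append, List.map_map, List.map_congr_left h2,
      List.map_congr_left (f := _ ∘ _) (g := fun p => 1 / ((m : ℂ) + 1) ^ k * ∑ j ∈ range m,
          t ^ (r.length + 1 - p.length) * (headPart p j : ℂ)) h1,
      List.sum_map_mul_left, List.sum_map_mul_left, ih, fillWeight]
    have h3 : ∀ L : List (List ℕ), (L.map fun p => ∑ j ∈ range m,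
        t ^ (r.length + 1 - p.length) * (headPart p j : ℂ)).sum =
        ∑ j ∈ range m, (L.map fun p => t ^ (r.length + 1 - p.length) * (headPart p j : ℂ)).sum := by
      intro L
      induction L with
      | nil => simp
      | cons p L ih => simp [ih, sum_add_distrib]
    rw [h3, sum_congr rfl fun j _ => ih l j, pow_add]
    have : ((m : ℂ) + 1) ≠ 0 := by exact_mod_cast Nat.succ_ne_zero m
    field_simp

lemma hasSum_tMZV (t : ℂ) (k : ℕ) (hk : 2 ≤ k) (r : List ℕ) (hr : ∀ l ∈ r, 1 ≤ l) :
    HasSum (fun m : ℕ => 1 / ((m : ℂ) + 1) ^ k * fillWeight t r m) (tMZV t (k :: r)) := by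
  simp_rw [← sum_fillings_headPart]
  rw [tMZV, fillings]
  have : ∀ L : List (List ℕ), (∀ p ∈ L, ∃ h q, p = h :: q ∧ k ≤ h ∧ ∀ l ∈ q, 1 ≤ l) →
      HasSum (fun m : ℕ => (L.map fun p =>
        t ^ (r.length + 1 - p.length) * (headPart p m : ℂ)).sum)
      (L.map fun p => t ^ ((k :: r).length - p.length) * (mzv p : ℂ)).sum := by
    intro L hL
    induction L with
    | nil => simp
    | cons p L ih =>
      simp only [List.map_cons, List.sum_cons]
      refine HasSum.add ?_ (ih fun q hq => hL q (by simp [hq]))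
      obtain ⟨h, q, rfl, hh, hq⟩ := hL p (by simp)
      refine HasSum.mul_left _ ?_
      exact (Complex.hasSum_ofReal.2 (hasSum_mzv_cons h (hk.trans hh) q hq))
  exact this _ (entries_of_mem_fillingsAux r hr k)

/-! ### The linear recursion and its majorant -/

/-- The terms, indexed by lists, of the solution of `E m = 1 + ∑ j < m, a j * E j + t * a m * E m`
with `a j = ∑' e, q j e`. -/
def genTerm {R : Type*} [CommSemiring R] (t : R) (q : ℕ → ℕ → R) : List ℕ → ℕ → R
  | [], _ => 1
  | e :: r, m => ∑ j ∈ range m, q j e * genTerm t q r j + t * (q m e * genTerm t q r m)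

lemma genTerm_nonneg {t : ℝ} (ht : 0 ≤ t) {q : ℕ → ℕ → ℝ} (hq : ∀ j e, 0 ≤ q j e)
    (r : List ℕ) (m : ℕ) : 0 ≤ genTerm t q r m := by
  induction r generalizing m with
  | nil => simp [genTerm]
  | cons e r ih =>
    exact add_nonneg (sum_nonneg fun j _ => mul_nonneg (hq _ _) (ih j))
      (mul_nonneg ht (mul_nonneg (hq _ _) (ih m)))

lemma norm_genTerm_le (t : ℂ) (q : ℕ → ℕ → ℂ) (r : List ℕ) (m : ℕ) :
    ‖genTerm t q r m‖ ≤ genTerm ‖t‖ (fun j e => ‖q j e‖) r m := by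
  induction r generalizing m with
  | nil => simp [genTerm]
  | cons e r ih =>
    refine (norm_add_le _ _).trans (add_le_add ?_ ?_)
    · refine (norm_sum_le _ _).trans (sum_le_sum fun j _ => ?_)
      rw [norm_mul]
      exact mul_le_mul_of_nonneg_left (ih j) (norm_nonneg _)
    · rw [norm_mul, norm_mul]
      exact mul_le_mul_of_nonneg_left (mul_le_mul_of_nonneg_left (ih m) (norm_nonneg _))
        (norm_nonneg _)

/-- Comparison principle: one more entry in the lists is one more iteration of the recursion started
from 1, and no iterate exceeds a supersolution E. Induction on the maximal length of the lists. -/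
lemma sum_genTerm_le {t : ℝ} (ht : 0 ≤ t) {q : ℕ → ℕ → ℝ} (hq : ∀ j e, 0 ≤ q j e)
    {a E : ℕ → ℝ} (ha : ∀ j (s : Finset ℕ), ∑ e ∈ s, q j e ≤ a j) (hE0 : ∀ m, 0 ≤ E m)
    (hE : ∀ m, 1 + ∑ j ∈ range m, a j * E j + t * (a m * E m) ≤ E m) (K : ℕ)
    (s : Finset (List ℕ)) (hs : ∀ r ∈ s, r.length ≤ K) (m : ℕ) :
    ∑ r ∈ s, genTerm t q r m ≤ E m := by
  classical
  have ha0 : ∀ j, 0 ≤ a j := fun j => by simpa using ha j ∅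
  induction K generalizing s m with
  | zero =>
    have h1 : s ⊆ {[]} := fun r hr => by
      have := hs r hr
      simp only [Nat.le_zero, List.length_eq_zero_iff] at this
      simp [this]
    calc _ ≤ ∑ r ∈ {[]}, genTerm t q r m :=
          sum_le_sum_of_subset_of_nonneg h1 fun _ _ _ => genTerm_nonneg ht hq _ _
      _ = 1 := by simp [genTerm]
      _ ≤ E m := by
          have h2 : 0 ≤ ∑ j ∈ range m, a j * E j :=
            sum_nonneg fun j _ => mul_nonneg (ha0 j) (hE0 j)
          have h3 : 0 ≤ t * (a m * E m) := mul_nonneg ht (mul_nonneg (ha0 m) (hE0 m))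
          linarith [hE m]
  | succ K ih =>
    -- Enlarging `s` to the box of all heads and tails makes the sum factor. The default head 0 of
    -- the empty list only adds nonnegative terms.
    set s1 : Finset ℕ := s.image (fun r => r.headD 0) with hs1
    set s2 : Finset (List ℕ) := s.image List.tail with hs2
    have hs2' : ∀ r ∈ s2, r.length ≤ K := by
      intro r hr
      obtain ⟨r', hr', rfl⟩ := mem_image.1 hr
      have := hs r' hr'
      simp; omega
    have h1 : s ⊆ insert [] ((s1 ×ˢ s2).image fun p => p.1 :: p.2) := by
      intro r hr
      cases r with
      | nil => simp
      | cons e r =>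
        refine mem_insert_of_mem (mem_image.2 ⟨(e, r), mem_product.2 ⟨?_, ?_⟩, rfl⟩)
        · exact mem_image.2 ⟨_, hr, rfl⟩
        · exact mem_image.2 ⟨_, hr, rfl⟩
    have h4 : ∀ j, ∑ p ∈ s1 ×ˢ s2, q j p.1 * genTerm t q p.2 j ≤ a j * E j := by
      intro j
      rw [sum_product, ← sum_mul_sum s1 s2 (fun e => q j e) (fun r => genTerm t q r j)]
      exact mul_le_mul (ha j s1) (ih s2 hs2' j)
        (sum_nonneg fun _ _ => genTerm_nonneg ht hq _ _) (ha0 j)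
    calc _ ≤ ∑ r ∈ insert [] ((s1 ×ˢ s2).image fun p => p.1 :: p.2), genTerm t q r m :=
          sum_le_sum_of_subset_of_nonneg h1 fun _ _ _ => genTerm_nonneg ht hq _ _
      _ = 1 + ∑ p ∈ s1 ×ˢ s2, genTerm t q (p.1 :: p.2) m := by
          rw [sum_insert (by simp), sum_image fun p _ p' _ h => by
            simpa [Prod.ext_iff] using h]
          simp [genTerm]
      _ = 1 + (∑ j ∈ range m, ∑ p ∈ s1 ×ˢ s2, q j p.1 * genTerm t q p.2 j +
            t * ∑ p ∈ s1 ×ˢ s2, q m p.1 * genTerm t q p.2 m) := by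
          simp only [genTerm, sum_add_distrib, mul_sum]
          rw [sum_comm]
      _ ≤ 1 + (∑ j ∈ range m, a j * E j + t * (a m * E m)) := by
          gcongr
          · exact h4 _
          · exact h4 _
      _ ≤ E m := by linarith [hE m]

lemma summable_genTerm {t : ℝ} (ht : 0 ≤ t) {q : ℕ → ℕ → ℝ} (hq : ∀ j e, 0 ≤ q j e)
    {a E : ℕ → ℝ} (ha : ∀ j (s : Finset ℕ), ∑ e ∈ s, q j e ≤ a j) (hE0 : ∀ m, 0 ≤ E m)
    (hE : ∀ m, 1 + ∑ j ∈ range m, a j * E j + t * (a m * E m) ≤ E m) (m : ℕ) :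
    Summable (fun r => genTerm t q r m) ∧ ∑' r, genTerm t q r m ≤ E m := by
  have h : ∀ s : Finset (List ℕ), ∑ r ∈ s, genTerm t q r m ≤ E m := fun s =>
    sum_genTerm_le ht hq ha hE0 hE (s.sup List.length) s (fun r hr => le_sup (f := List.length) hr) m
  exact ⟨summable_of_sum_le (fun r => genTerm_nonneg ht hq r m) h,
    Real.tsum_le_of_sum_le (fun r => genTerm_nonneg ht hq r m) h⟩

/-- With a_j = ε/(j+1) and E_m = 2√(m+1), the sum is at most 4ε√m ≤ √(m+1)/2 and the last term at
most 2tε ≤ 1/2. The total is at most 3/2 + √(m+1)/2 ≤ 2√(m+1). -/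
lemma sqrt_supersolution {t ε : ℝ} (_hε0 : 0 ≤ ε) (hε : ε ≤ 1 / 8) (_ht : 0 ≤ t) (htε : t * ε ≤ 1 / 4)
    (m : ℕ) : 1 + ∑ j ∈ range m, ε / ((j : ℝ) + 1) * (2 * √((j : ℝ) + 1)) +
      t * (ε / ((m : ℝ) + 1) * (2 * √((m : ℝ) + 1))) ≤ 2 * √((m : ℝ) + 1) := by
  have hs : ∀ j : ℕ, ε / ((j : ℝ) + 1) * (2 * √((j : ℝ) + 1)) = 2 * ε * (1 / √((j : ℝ) + 1)) := by
    intro j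
    have h0 : (0 : ℝ) < √((j : ℝ) + 1) := Real.sqrt_pos.2 (by positivity)
    have h2 : √((j : ℝ) + 1) ^ 2 = j + 1 := Real.sq_sqrt (by positivity)
    field_simp
    rw [h2]
  simp_rw [hs]
  rw [← mul_sum]
  have h1 := sum_inv_sqrt_le m
  have h2 : √(m : ℝ) ≤ √((m : ℝ) + 1) := Real.sqrt_le_sqrt (by linarith)
  have h3 : 1 ≤ √((m : ℝ) + 1) := Real.one_le_sqrt.2 (by linarith [Nat.cast_nonneg (α := ℝ) m])
  have h4 : 1 / √((m : ℝ) + 1) ≤ 1 := by rw [div_le_one (by linarith)]; exact h3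
  have h40 : 0 ≤ 1 / √((m : ℝ) + 1) := by positivity
  have h5 : 2 * ε * ∑ j ∈ range m, 1 / √((j : ℝ) + 1) ≤ 2 * (1 / 8) * (2 * √((m : ℝ) + 1)) := by
    gcongr
    linarith
  have h6 : t * (2 * ε * (1 / √((m : ℝ) + 1))) ≤ 2 * (1 / 4) * 1 := by
    calc _ = 2 * (t * ε) * (1 / √((m : ℝ) + 1)) := by ring
      _ ≤ _ := by gcongr
  linarith

lemma tsum_list {f : List ℕ → ℂ} (hf : Summable f) :
    ∑' r, f r = f [] + ∑' p : ℕ × List ℕ, f (p.1 :: p.2) := by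
  classical
  have hinj : Function.Injective fun p : ℕ × List ℕ => p.1 :: p.2 := fun p p' h => by
    simpa [Prod.ext_iff] using h
  rw [hf.tsum_eq_add_tsum_ite [], ← hinj.tsum_eq]
  · simp
  · intro r hr
    cases r with
    | nil => simp at hr
    | cons e r => exact ⟨(e, r), rfl⟩

lemma tsum_genTerm (t : ℂ) (q : ℕ → ℕ → ℂ) (hq : ∀ j, Summable fun e => ‖q j e‖)
    (hx : ∀ m, Summable fun r => ‖genTerm t q r m‖) (m : ℕ) :
    ∑' r, genTerm t q r m = 1 + ∑ j ∈ range m, (∑' e, q j e) * (∑' r, genTerm t q r j) +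
      t * ((∑' e, q m e) * (∑' r, genTerm t q r m)) := by
  refine (tsum_list (hx m).of_norm).trans ?_
  have h : ∀ j, Summable fun p : ℕ × List ℕ => q j p.1 * genTerm t q p.2 j := fun j =>
    summable_mul_of_summable_norm (f := q j) (g := fun r => genTerm t q r j) (hq j) (hx j)
  have h' : ∀ j, (∑' e, q j e) * (∑' r, genTerm t q r j) =
      ∑' p : ℕ × List ℕ, q j p.1 * genTerm t q p.2 j := fun j =>
    tsum_mul_tsum_of_summable_norm (f := q j) (g := fun r => genTerm t q r j) (hq j) (hx j)
  simp only [genTerm, h']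
  rw [Summable.tsum_add (summable_sum fun j _ => h j) ((h m).mul_left t),
    Summable.tsum_finsetSum fun j _ => h j, tsum_mul_left, add_assoc]

/-! ### The generating function as a sum over lists and over the leading index -/

/-- The weight of an entry `e + 1` in the generating function. -/
noncomputable def entryWeight (u v w : ℂ) : ℕ → ℂ
  | 0 => v
  | e + 1 => w ^ 2 * u ^ e

lemma fillWeight_eq_genTerm (t u v w : ℂ) (r : List ℕ) (m : ℕ) :
    (r.map (entryWeight u v w)).prod * fillWeight t (r.map Nat.succ) m =
      genTerm t (fun j e => entryWeight u v w e * (1 / ((j : ℂ) + 1) ^ (e + 1))) r m := by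
  induction r generalizing m with
  | nil => simp [fillWeight, genTerm]
  | cons e r ih =>
    simp only [List.map_cons, List.prod_cons, fillWeight, genTerm, ← ih]
    rw [mul_add, mul_sum]
    congr 1
    · exact sum_congr rfl fun j _ => by rw [Nat.succ_eq_add_one]; ring
    · rw [Nat.succ_eq_add_one]; ring

/-- An entry 1 contributes v; an entry e + 2 raises the height by one and contributes w² u^e. The
witnesses A and B replace the truncated subtractions weight - depth - height and depth - height. -/
lemma entryWeight_prod (u v w : ℂ) (r : List ℕ) :
    ∃ A B, (r.map Nat.succ).sum = (r.map Nat.succ).length + height (r.map Nat.succ) + A ∧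
      (r.map Nat.succ).length = height (r.map Nat.succ) + B ∧
      (r.map (entryWeight u v w)).prod = u ^ A * v ^ B * w ^ (2 * height (r.map Nat.succ)) := by
  induction r with
  | nil => exact ⟨0, 0, by simp [height]⟩
  | cons e r ih =>
    obtain ⟨A, B, h1, h2, h3⟩ := ih
    cases e with
    | zero =>
      have hh : height ((0 :: r).map Nat.succ) = height (r.map Nat.succ) := by simp [height]
      refine ⟨A, B + 1, ?_, ?_, ?_⟩
      · rw [hh, List.map_cons, List.sum_cons, List.length_cons]; omega
      · rw [hh, List.map_cons, List.length_cons]; omega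
      · rw [hh, List.map_cons, List.prod_cons, h3, entryWeight]; ring
    | succ e =>
      have hh : height (((e + 1) :: r).map Nat.succ) = height (r.map Nat.succ) + 1 := by
        simp [height]
      refine ⟨A + e, B, ?_, ?_, ?_⟩
      · rw [hh, List.map_cons, List.sum_cons, List.length_cons]; omega
      · rw [hh, List.map_cons, List.length_cons]; omega
      · rw [hh, List.map_cons, List.prod_cons, h3, entryWeight]; ring

/-- The admissible index with first entry `i.1 + 2` and other entries `e + 1`, `e ∈ i.2`. -/
def indexOf (i : ℕ × List ℕ) : List ℕ := (i.1 + 2) :: i.2.map Nat.succ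

lemma indexOf_injective : Function.Injective indexOf := by
  rintro ⟨j, r⟩ ⟨j', r'⟩ h
  simp only [indexOf, List.cons.injEq, Nat.add_right_cancel_iff] at h
  exact Prod.ext h.1 (List.map_injective_iff.2 Nat.succ_injective h.2)

lemma indexOf_pos (i : ℕ × List ℕ) {k : ℕ} (hk : k ∈ indexOf i) : 0 < k := by
  simp only [indexOf, List.mem_cons, List.mem_map] at hk
  rcases hk with rfl | ⟨e, -, rfl⟩ <;> omega

lemma exists_indexOf (ks : List ℕ) (h0 : ∀ k ∈ ks, 0 < k) (h2 : 2 ≤ ks.headD 0) :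
    ∃ i, indexOf i = ks := by
  cases ks with
  | nil => simp at h2
  | cons k r =>
    refine ⟨(k - 2, r.map Nat.pred), ?_⟩
    simp only [List.headD_cons] at h2
    simp only [indexOf, List.map_map]
    congr 1
    · omega
    · conv_rhs => rw [← List.map_id r]
      refine List.map_congr_left fun l hl => ?_
      have := h0 l (by simp [hl])
      simp only [Function.comp, id, Nat.pred_eq_sub_one]; omega

lemma height_indexOf (i : ℕ × List ℕ) :
    height (indexOf i) = height (i.2.map Nat.succ) + 1 := by
  simp [height, indexOf]

/-- Weight, depth and height of an admissible index. -/
def tripleOf (i : ℕ × List ℕ) : Triples :=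
  ⟨((indexOf i).sum, (indexOf i).length, height (indexOf i)), by
    obtain ⟨A, B, h1, h2, -⟩ := entryWeight_prod 0 0 0 i.2
    rw [height_indexOf, indexOf, List.sum_cons, List.length_cons]
    refine ⟨?_, ?_, ?_⟩ <;> dsimp only <;> omega⟩

/-- The contribution of an admissible index to the generating function. -/
noncomputable def indexTerm (t u v w : ℂ) (i : ℕ × List ℕ) : ℂ :=
  tMZV t (indexOf i) * (u ^ i.1 * (i.2.map (entryWeight u v w)).prod)

lemma indexTerm_eq (t u v w : ℂ) (i : ℕ × List ℕ) (q : Triples) (h : tripleOf i = q) :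
    indexTerm t u v w i = tMZV t (indexOf i) * (u ^ (q.1.1 - q.1.2.1 - q.1.2.2) *
      v ^ (q.1.2.1 - q.1.2.2) * w ^ (2 * q.1.2.2 - 2)) := by
  subst h
  obtain ⟨A, B, h1, h2, h3⟩ := entryWeight_prod u v w i.2
  simp only [tripleOf, indexTerm, h3]
  rw [height_indexOf, show (indexOf i).sum - (indexOf i).length -
    (height (i.2.map Nat.succ) + 1) = i.1 + A by
      rw [indexOf, List.sum_cons, List.length_cons]; omega,
    show (indexOf i).length - (height (i.2.map Nat.succ) + 1) = B by
      rw [indexOf, List.length_cons]; omega,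
    show 2 * (height (i.2.map Nat.succ) + 1) - 2 = 2 * height (i.2.map Nat.succ) by omega]
  ring

lemma tripleOf_eq_iff (i : ℕ × List ℕ) (q : Triples) :
    tripleOf i = q ↔ (indexOf i).sum = q.1.1 ∧ (indexOf i).length = q.1.2.1 ∧
      height (indexOf i) = q.1.2.2 := by
  rw [Subtype.ext_iff, Prod.ext_iff, Prod.ext_iff]
  rfl

lemma exists_fiber_equiv (q : Triples) :
    ∃ F : tripleOf ⁻¹' {q} ≃ {c // c ∈ admissibleIndices q.1.1 q.1.2.1 q.1.2.2},
      ∀ i, (F i).1.blocks = indexOf i.1 := by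
  have hmem : ∀ i : tripleOf ⁻¹' {q}, (indexOf i.1).sum = q.1.1 ∧
      (indexOf i.1).length = q.1.2.1 ∧ height (indexOf i.1) = q.1.2.2 :=
    fun i => (tripleOf_eq_iff i.1 q).1 i.2
  have hadm : ∀ c : Composition q.1.1, c ∈ admissibleIndices q.1.1 q.1.2.1 q.1.2.2 ↔
      2 ≤ c.blocks.headD 0 ∧ c.length = q.1.2.1 ∧ height c.blocks = q.1.2.2 := fun c => by
    simp only [admissibleIndices, mem_filter, mem_univ, true_and]
  refine ⟨Equiv.ofBijective (fun i => ⟨⟨indexOf i.1, fun h => indexOf_pos i.1 h, (hmem i).1⟩,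
    (hadm _).2 ⟨Nat.le_add_left 2 _, (hmem i).2.1, (hmem i).2.2⟩⟩) ⟨fun i j h => ?_, ?_⟩,
    fun i => rfl⟩
  · exact Subtype.ext (indexOf_injective (congrArg (fun c => c.1.blocks) h))
  · rintro ⟨c, hc⟩
    have hc := (hadm c).1 hc
    obtain ⟨i, hi⟩ := exists_indexOf c.blocks (fun k hk => c.blocks_pos hk) hc.1
    exact ⟨⟨i, (tripleOf_eq_iff i q).2 ⟨by rw [hi, c.blocks_sum], by rw [hi]; exact hc.2.1,
      by rw [hi]; exact hc.2.2⟩⟩, Subtype.ext (Composition.ext hi)⟩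

lemma tsum_fiber (t u v w : ℂ) (q : Triples) :
    ∑' i : tripleOf ⁻¹' {q}, indexTerm t u v w i = Φ₀Term t u v w q := by
  obtain ⟨F, hF⟩ := exists_fiber_equiv q
  set W : ℂ := u ^ (q.1.1 - q.1.2.1 - q.1.2.2) * v ^ (q.1.2.1 - q.1.2.2) * w ^ (2 * q.1.2.2 - 2)
    with hW
  have h1 : ∀ i : tripleOf ⁻¹' {q}, indexTerm t u v w i = tMZV t (F i).1.blocks * W :=
    fun i => by rw [hF]; exact indexTerm_eq t u v w i.1 _ i.2
  rw [tsum_congr h1, F.tsum_eq (fun c => tMZV t c.1.blocks * W),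
    Finset.tsum_subtype _ (fun c : Composition q.1.1 => tMZV t c.blocks * W),
    ← sum_mul, Φ₀Term, X₀, hW]
  ring

lemma hasSum_Φ₀Term (t u v w a : ℂ) (h : HasSum (indexTerm t u v w) a) :
    HasSum (Φ₀Term t u v w) a := by
  have := h.tsum_fiberwise tripleOf
  rwa [funext (tsum_fiber t u v w)] at this

/-- The summand `q j e` of the generating function. -/
noncomputable def blockTerm (u v w : ℂ) (j e : ℕ) : ℂ :=
  entryWeight u v w e * (1 / ((j : ℂ) + 1) ^ (e + 1))

lemma hasSum_indexTerm (t u v w : ℂ) (i : ℕ × List ℕ) :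
    HasSum (fun m : ℕ => u ^ i.1 * (1 / ((m : ℂ) + 1) ^ (i.1 + 2)) *
      genTerm t (blockTerm u v w) i.2 m) (indexTerm t u v w i) := by
  have h := (hasSum_tMZV t (i.1 + 2) (by omega) (i.2.map Nat.succ) (fun l hl => by
    obtain ⟨e, -, rfl⟩ := List.mem_map.1 hl; omega)).mul_right
    (u ^ i.1 * (i.2.map (entryWeight u v w)).prod)
  refine h.congr_fun ?_ 
  intro m
  change _ * genTerm t (fun j e => entryWeight u v w e * (1 / ((j : ℂ) + 1) ^ (e + 1))) i.2 m = _
  rw [← fillWeight_eq_genTerm]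
  ring

lemma hasSum_geom_block (u : ℂ) (hu : ‖u‖ < 1) (j : ℕ) :
    HasSum (fun e : ℕ => u ^ e * (1 / ((j : ℂ) + 1) ^ (e + 2))) (1 / (((j : ℂ) + 1) * (j + 1 - u))) ∧
    HasSum (fun e : ℕ => ‖u ^ e * (1 / ((j : ℂ) + 1) ^ (e + 2))‖)
      (1 / (((j : ℝ) + 1) * (j + 1 - ‖u‖))) := by
  have hj : ((j : ℂ) + 1) ≠ 0 := by exact_mod_cast Nat.succ_ne_zero j
  have hn : ‖(j : ℂ) + 1‖ = (j : ℝ) + 1 := norm_natCast_add_one j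
  have hj' : (0 : ℝ) < (j : ℝ) + 1 := by positivity
  have hlt : ‖u‖ < (j : ℝ) + 1 := by linarith [Nat.cast_nonneg (α := ℝ) j]
  have h1 : ‖u / ((j : ℂ) + 1)‖ < 1 := by
    rw [norm_div, hn, div_lt_one hj']; exact hlt
  have h2 : (j : ℂ) + 1 - u ≠ 0 := by
    intro h
    rw [sub_eq_zero] at h
    rw [← h, hn] at hlt
    exact lt_irrefl _ hlt
  have h3 : (0 : ℝ) < j + 1 - ‖u‖ := by linarith
  constructor
  · have h := (hasSum_geometric_of_norm_lt_one h1).mul_left (1 / ((j : ℂ) + 1) ^ 2)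
    convert! h using 1
    · funext e; rw [div_pow, pow_add]; field_simp
    · field_simp
  · have h := (hasSum_geometric_of_lt_one (norm_nonneg _) h1).mul_left (1 / ((j : ℝ) + 1) ^ 2)
    rw [norm_div, hn] at h
    convert! h using 1
    · funext e
      rw [norm_mul, norm_div, norm_pow, norm_pow, hn, norm_one, div_pow, pow_add]; field_simp
    · field_simp

/-- `a m = ∑' e, q m e`. -/
noncomputable def blockSum (u v w : ℂ) (j : ℕ) : ℂ :=
  v / ((j : ℂ) + 1) + w ^ 2 / (((j : ℂ) + 1) * (j + 1 - u))

lemma hasSum_blockTerm (u v w : ℂ) (hu : ‖u‖ < 1) (j : ℕ) :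
    HasSum (blockTerm u v w j) (blockSum u v w j) ∧
    HasSum (fun e => ‖blockTerm u v w j e‖)
      (‖v‖ / ((j : ℝ) + 1) + ‖w‖ ^ 2 / (((j : ℝ) + 1) * (j + 1 - ‖u‖))) := by
  obtain ⟨h1, h2⟩ := hasSum_geom_block u hu j
  have hn : ‖(j : ℂ) + 1‖ = (j : ℝ) + 1 := norm_natCast_add_one j
  constructor
  · rw [← hasSum_nat_add_iff' 1]
    convert! h1.mul_left (w ^ 2) using 1
    · funext e; simp only [blockTerm, entryWeight]; ring
    · simp only [blockSum, sum_range_one, blockTerm, entryWeight]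
      generalize ((j : ℂ) + 1) * (j + 1 - u) = d
      ring
  · rw [← hasSum_nat_add_iff' 1]
    convert! h2.mul_left (‖w‖ ^ 2) using 1
    · funext e
      simp only [blockTerm, entryWeight]
      rw [← norm_pow, ← norm_mul]; congr 1; ring
    · simp only [sum_range_one, blockTerm, entryWeight, norm_mul, norm_div, norm_pow, hn, norm_one]
      generalize ((j : ℝ) + 1) * (j + 1 - ‖u‖) = d
      ring

/-- `E m = ∑' r, genTerm r m`. -/
noncomputable def genSum (t u v w : ℂ) (m : ℕ) : ℂ := ∑' r, genTerm t (blockTerm u v w) r m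

lemma genSum_spec (t u v w : ℂ) (hu : ‖u‖ ≤ 1 / 2) (h1 : ‖v‖ + 2 * ‖w‖ ^ 2 ≤ 1 / 8)
    (h2 : ‖t‖ * (‖v‖ + 2 * ‖w‖ ^ 2) ≤ 1 / 4) (m : ℕ) :
    Summable (fun r => ‖genTerm t (blockTerm u v w) r m‖) ∧
    ∑' r, ‖genTerm t (blockTerm u v w) r m‖ ≤ 2 * √((m : ℝ) + 1) ∧
    genSum t u v w m = 1 + ∑ j ∈ range m, blockSum u v w j * genSum t u v w j +
      t * (blockSum u v w m * genSum t u v w m) := by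
  have hb := hasSum_blockTerm u v w (by linarith)
  have hle : ∀ j (s : Finset ℕ), ∑ e ∈ s, ‖blockTerm u v w j e‖ ≤
      (‖v‖ + 2 * ‖w‖ ^ 2) / ((j : ℝ) + 1) := by
    intro j s
    refine (sum_le_hasSum s (fun _ _ => norm_nonneg _) (hb j).2).trans ?_
    have hj : (0 : ℝ) < (j : ℝ) + 1 := by positivity
    have h3 : (1 : ℝ) / 2 ≤ j + 1 - ‖u‖ := by linarith [Nat.cast_nonneg (α := ℝ) j]
    rw [add_div]
    refine add_le_add le_rfl ?_
    rw [← div_div, div_right_comm]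
    gcongr
    rw [div_le_iff₀ (by linarith)]
    nlinarith [sq_nonneg ‖w‖]
  have hS := fun m => summable_genTerm (norm_nonneg t) (q := fun j e => ‖blockTerm u v w j e‖)
    (fun _ _ => norm_nonneg _) (E := fun m => 2 * √((m : ℝ) + 1)) hle
    (fun m => by positivity)
    (sqrt_supersolution (by positivity) h1 (norm_nonneg t) h2) m
  have hs : ∀ m, Summable (fun r => ‖genTerm t (blockTerm u v w) r m‖) := fun m =>
    Summable.of_nonneg_of_le (fun _ => norm_nonneg _) (fun r => norm_genTerm_le _ _ r m) (hS m).1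
  refine ⟨hs m, ((hs m).tsum_le_tsum (fun r => norm_genTerm_le _ _ r m) (hS m).1).trans (hS m).2, ?_⟩
  have := tsum_genTerm t (blockTerm u v w) (fun j => (hb j).2.summable) hs m
  simp only [fun j => (hb j).1.tsum_eq] at this
  exact this

/-- The generating function as a simple sum. -/
lemma hasSum_Φ₀Term_genSum (t u v w : ℂ) (hu : ‖u‖ ≤ 1 / 2) (h1 : ‖v‖ + 2 * ‖w‖ ^ 2 ≤ 1 / 8)
    (h2 : ‖t‖ * (‖v‖ + 2 * ‖w‖ ^ 2) ≤ 1 / 4) :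
    HasSum (Φ₀Term t u v w)
      (∑' m : ℕ, 1 / (((m : ℂ) + 1) * (m + 1 - u)) * genSum t u v w m) := by
  have hE := genSum_spec t u v w hu h1 h2
  have hg := hasSum_geom_block u (by linarith)
  -- One absolutely summable family over (m, e, r). Summing over m first gives the contribution of
  -- an admissible index; summing over (e, r) first factors into a geometric series times `genSum`.
  set h : ℕ × (ℕ × List ℕ) → ℂ := fun p => u ^ p.2.1 * (1 / ((p.1 : ℂ) + 1) ^ (p.2.1 + 2)) *
      genTerm t (blockTerm u v w) p.2.2 p.1 with hh
  have hm : ∀ m, Summable fun i : ℕ × List ℕ => ‖h (m, i)‖ := fun m =>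
    (Summable.mul_norm (f := fun e : ℕ => u ^ e * (1 / ((m : ℂ) + 1) ^ (e + 2)))
      (g := fun r => genTerm t (blockTerm u v w) r m) (hg m).2.summable (hE m).1)
  have hmt : ∀ m, ∑' i : ℕ × List ℕ, h (m, i) =
      1 / (((m : ℂ) + 1) * (m + 1 - u)) * genSum t u v w m := fun m => by
    rw [← (hg m).1.tsum_eq, genSum]
    exact (tsum_mul_tsum_of_summable_norm (f := fun e : ℕ => u ^ e * (1 / ((m : ℂ) + 1) ^ (e + 2)))
      (g := fun r => genTerm t (blockTerm u v w) r m) (hg m).2.summable (hE m).1).symm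
  have hmn : ∀ m, ∑' i : ℕ × List ℕ, ‖h (m, i)‖ ≤ 4 * (√((m : ℝ) + 1) / ((m : ℝ) + 1) ^ 2) := by
    intro m
    have e1 : ∑' i : ℕ × List ℕ, ‖h (m, i)‖ =
        (1 / (((m : ℝ) + 1) * (m + 1 - ‖u‖))) * ∑' r, ‖genTerm t (blockTerm u v w) r m‖ := by
      rw [← (hg m).2.tsum_eq]
      rw [tsum_mul_tsum_of_summable_norm
        (f := fun e : ℕ => ‖u ^ e * (1 / ((m : ℂ) + 1) ^ (e + 2))‖)
        (g := fun r => ‖genTerm t (blockTerm u v w) r m‖) (hg m).2.summable.norm (hE m).1.norm]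
      exact tsum_congr fun i => norm_mul _ _
    have hj : (0 : ℝ) < (m : ℝ) + 1 := by positivity
    have h3 : ((m : ℝ) + 1) / 2 ≤ m + 1 - ‖u‖ := by linarith [Nat.cast_nonneg (α := ℝ) m]
    calc _ ≤ (1 / (((m : ℝ) + 1) * (((m : ℝ) + 1) / 2))) * (2 * √((m : ℝ) + 1)) := by
          rw [e1]
          refine mul_le_mul ?_ (hE m).2.1 (tsum_nonneg fun _ => norm_nonneg _) (by positivity)
          exact one_div_le_one_div_of_le (by positivity) (by gcongr)
      _ = _ := by field_simp; norm_num
  have hsum : Summable h := by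
    refine Summable.of_norm ((summable_prod_of_nonneg fun _ => norm_nonneg _).2 ⟨hm, ?_⟩)
    exact Summable.of_nonneg_of_le (fun m => tsum_nonneg fun _ => norm_nonneg _) hmn
      (summable_sqrt_div_sq.mul_left 4)
  refine hasSum_Φ₀Term t u v w _ ?_
  have h3 := (Equiv.prodComm _ _).hasSum_iff.2 hsum.hasSum
  have h4 := h3.prod_fiberwise fun i => hasSum_indexTerm t u v w i
  convert h4 using 1
  rw [hsum.tsum_prod' fun m => (hm m).of_norm]
  exact tsum_congr fun m => (hmt m).symm

/-! ### Solving the recursion in closed form -/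

/-- The summand of the generating function in its hypergeometric form. -/
noncomputable def prodTerm (α β γ₁ γ₂ : ℂ) (m : ℕ) : ℂ :=
  (∏ l ∈ range m, ((l : ℂ) + 1 + γ₁) * (l + 1 + γ₂) / ((l + 1 - α) * (l + 1 - β))) *
    (1 / (((m : ℂ) + 1 - α) * (m + 1 - β)))

/-- The parameters `α, β, γ₁, γ₂` belonging to `t, u, v, w`. -/
structure IsParam (t u v w α β γ₁ γ₂ : ℂ) : Prop where
  add : α + β = u + v * t
  mul : α * β = t * (u * v - w ^ 2)
  add' : γ₁ + γ₂ = -u - (t - 1) * v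
  mul' : γ₁ * γ₂ = (t - 1) * (u * v - w ^ 2)

lemma blockSum_norm_le (u v w : ℂ) (hu : ‖u‖ ≤ 1 / 2) (m : ℕ) :
    ‖blockSum u v w m‖ ≤ ‖v‖ + 2 * ‖w‖ ^ 2 := by
  have hb := (hasSum_blockTerm u v w (by linarith) m)
  rw [← hb.1.tsum_eq]
  refine (norm_tsum_le_tsum_norm hb.2.summable).trans ?_
  rw [hb.2.tsum_eq]
  have h0 := Nat.cast_nonneg (α := ℝ) m
  have h1 : (1 : ℝ) ≤ m + 1 := by linarith
  refine add_le_add (div_le_self (norm_nonneg _) h1) ?_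
  have h3 : (1 : ℝ) / 2 ≤ (m + 1) * (m + 1 - ‖u‖) := by nlinarith
  rw [div_le_iff₀ (by linarith)]
  nlinarith [sq_nonneg ‖w‖]

/-- Put S_m = 1 + ∑_{j<m} a_j E_j. The recursion reads E_m (1 - t a_m) = S_m, so S_{m+1}/S_m = (1 +
(1-t) a_m)/(1 - t a_m). Multiplied by (m+1)(m+1-u), numerator and denominator become quadratics in m
+ 1 with roots -γ₁, -γ₂ and α, β. -/
lemma block_mul_genSum {t u v w α β γ₁ γ₂ : ℂ} (hp : IsParam t u v w α β γ₁ γ₂)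
    (hu : ‖u‖ ≤ 1 / 2) (h1 : ‖v‖ + 2 * ‖w‖ ^ 2 ≤ 1 / 8)
    (h2 : ‖t‖ * (‖v‖ + 2 * ‖w‖ ^ 2) ≤ 1 / 4) (m : ℕ) :
    1 / (((m : ℂ) + 1) * (m + 1 - u)) * genSum t u v w m = prodTerm α β γ₁ γ₂ m := by
  have hd : ∀ m : ℕ, ((m : ℂ) + 1) * (m + 1 - u) ≠ 0 := by
    intro m
    have hj : ((m : ℂ) + 1) ≠ 0 := by exact_mod_cast Nat.succ_ne_zero m
    refine mul_ne_zero hj fun h => ?_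
    rw [sub_eq_zero] at h
    have hn : ‖(m : ℂ) + 1‖ = (m : ℝ) + 1 := norm_natCast_add_one m
    rw [← h, hn] at hu
    linarith [Nat.cast_nonneg (α := ℝ) m]
  have hta : ∀ m : ℕ, 1 - t * blockSum u v w m ≠ 0 := by
    intro m h
    rw [sub_eq_zero] at h
    have h3 : ‖t * blockSum u v w m‖ ≤ 1 / 4 := by
      rw [norm_mul]
      exact (mul_le_mul_of_nonneg_left (blockSum_norm_le u v w hu m) (norm_nonneg _)).trans h2
    rw [← h, norm_one] at h3
    norm_num at h3
  have hbd : ∀ m : ℕ, blockSum u v w m * (((m : ℂ) + 1) * (m + 1 - u)) =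
      v * (m + 1 - u) + w ^ 2 := by
    intro m
    have h1 := left_ne_zero_of_mul (hd m)
    have h2 := right_ne_zero_of_mul (hd m)
    rw [blockSum]; field_simp
  have e1 : ∀ m : ℕ, ((m : ℂ) + 1) * (m + 1 - u) * (1 - t * blockSum u v w m) =
      (m + 1 - α) * (m + 1 - β) := by
    intro m
    linear_combination (-t) * hbd m + (m + 1) * hp.add - hp.mul
  have e2 : ∀ m : ℕ, ((m : ℂ) + 1) * (m + 1 - u) * (1 + (1 - t) * blockSum u v w m) =
      (m + 1 + γ₁) * (m + 1 + γ₂) := by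
    intro m
    linear_combination (1 - t) * hbd m - (m + 1) * hp.add' - hp.mul'
  have hE : ∀ m, genSum t u v w m * (1 - t * blockSum u v w m) =
      1 + ∑ j ∈ range m, blockSum u v w j * genSum t u v w j := fun m => by
    linear_combination (genSum_spec t u v w hu h1 h2 m).2.2
  have hR : ∀ m : ℕ, 1 + ∑ j ∈ range m, blockSum u v w j * genSum t u v w j =
      ∏ l ∈ range m, ((l : ℂ) + 1 + γ₁) * (l + 1 + γ₂) / ((l + 1 - α) * (l + 1 - β)) := by
    intro m
    induction m with
    | zero => simp
    | succ m ih =>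
      rw [sum_range_succ, ← add_assoc, prod_range_succ, ← ih, ← hE, ← e1, ← e2,
        mul_div_mul_left _ _ (hd m)]
      have := hta m
      field_simp
      ring
  rw [prodTerm, ← hR, ← hE, ← e1]
  have h1 := hta m
  have h2 := hd m
  field_simp

lemma hasSum_Φ₀Term_prodTerm {t u v w α β γ₁ γ₂ : ℂ} (hp : IsParam t u v w α β γ₁ γ₂)
    (hu : ‖u‖ ≤ 1 / 2) (h1 : ‖v‖ + 2 * ‖w‖ ^ 2 ≤ 1 / 8)
    (h2 : ‖t‖ * (‖v‖ + 2 * ‖w‖ ^ 2) ≤ 1 / 4) :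
    HasSum (Φ₀Term t u v w) (∑' m, prodTerm α β γ₁ γ₂ m) := by
  simp_rw [← block_mul_genSum hp hu h1 h2]
  exact hasSum_Φ₀Term_genSum t u v w hu h1 h2

lemma exists_radius (t : ℂ) : ∃ r : ℝ, 0 < r ∧ ∀ u v w : ℂ, ‖u‖ < r → ‖v‖ < r → ‖w‖ < r →
    ‖u‖ ≤ 1 / 2 ∧ ‖v‖ + 2 * ‖w‖ ^ 2 ≤ 1 / 8 ∧ ‖t‖ * (‖v‖ + 2 * ‖w‖ ^ 2) ≤ 1 / 4 := by
  -- For r ≤ 1/24 one has ‖v‖ + 2‖w‖² ≤ 3r ≤ 1/8, and the factor 1 + ‖t‖ absorbs ‖t‖.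
  refine ⟨1 / (24 * (1 + ‖t‖)), by positivity, fun u v w hu hv hw => ?_⟩
  have ht := norm_nonneg t
  have hr : 1 / (24 * (1 + ‖t‖)) ≤ 1 / 24 :=
    one_div_le_one_div_of_le (by norm_num) (by linarith)
  have hw2 : ‖w‖ ^ 2 ≤ ‖w‖ := by nlinarith [norm_nonneg w]
  have h3 : ‖v‖ + 2 * ‖w‖ ^ 2 ≤ 3 * (1 / (24 * (1 + ‖t‖))) := by linarith
  refine ⟨by linarith, by linarith, ?_⟩
  calc _ ≤ (1 + ‖t‖) * (3 * (1 / (24 * (1 + ‖t‖)))) := by gcongr; linarith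
    _ = 1 / 8 := by field_simp; norm_num
    _ ≤ _ := by norm_num

/-! ### Growth of the summands and the identity principle along a ray -/

/-- Keeps Re z to first order instead of ‖z‖, so that the growth exponent of the product is governed
by Re v and not by ‖v‖. -/
lemma norm_one_add_le_exp (z : ℂ) : ‖1 + z‖ ≤ Real.exp (z.re + ‖z‖ ^ 2 / 2) := by
  have h1 : ‖1 + z‖ ^ 2 = 1 + 2 * z.re + ‖z‖ ^ 2 := by
    rw [Complex.sq_norm, Complex.sq_norm, Complex.normSq_apply, Complex.normSq_apply]
    simp; ring
  refine le_of_sq_le_sq ?_ (Real.exp_pos _).le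
  rw [h1, ← Real.exp_nat_mul]
  refine le_trans (le_of_eq ?_) (Real.add_one_le_exp _)
  push_cast; ring

lemma mul_le_norm_sub {α : ℂ} {δ : ℝ} (hδ : δ ≤ 1) (hα : α.re ≤ 1 - δ) (l : ℕ) :
    δ * ((l : ℝ) + 1) ≤ ‖(l : ℂ) + 1 - α‖ := by
  refine le_trans ?_ (Complex.re_le_norm _)
  simp only [Complex.sub_re, Complex.add_re, Complex.natCast_re, Complex.one_re]
  nlinarith [Nat.cast_nonneg (α := ℝ) l]

lemma sum_range_inv_le (m : ℕ) :
    ∑ l ∈ range m, 1 / ((l : ℝ) + 1) ≤ 1 + Real.log ((m : ℝ) + 1) := by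
  have h := harmonic_le_one_add_log m
  have e : ((harmonic m : ℚ) : ℝ) = ∑ l ∈ range m, 1 / ((l : ℝ) + 1) := by
    rw [harmonic]; push_cast; simp
  rw [e] at h
  refine h.trans ?_
  rcases Nat.eq_zero_or_pos m with rfl | hm
  · simp
  · have : (0 : ℝ) < m := by exact_mod_cast hm
    linarith [Real.log_le_log this (by linarith : (m : ℝ) ≤ m + 1)]

lemma summable_one_div_add_one_sq : Summable fun l : ℕ => 1 / ((l : ℝ) + 1) ^ 2 := by
  have := (summable_nat_add_iff 1).2 (Real.summable_one_div_nat_pow.2 (show 1 < 2 by norm_num))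
  exact_mod_cast this

/-- Each factor is 1 + z with z = V/(l+1) + O((l+1)^(-2)) and V = α + β + γ₁ + γ₂, so the product is
at most a constant times exp(ρ ∑ 1/(l+1)). The constant depends only on M, δ, ρ, as the Weierstrass
test along the ray requires. -/
lemma prodTerm_bound {M δ ρ : ℝ} (hM : 0 ≤ M) (hδ0 : 0 < δ) (hδ : δ ≤ 1) (hρ : 0 ≤ ρ) :
    ∃ C, ∀ α β γ₁ γ₂ : ℂ, ‖α‖ ≤ M → ‖β‖ ≤ M → ‖γ₁‖ ≤ M → ‖γ₂‖ ≤ M → α.re ≤ 1 - δ →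
      β.re ≤ 1 - δ → (α + β + γ₁ + γ₂).re ≤ ρ → ∀ m : ℕ,
      ‖prodTerm α β γ₁ γ₂ m‖ ≤ C * ((m : ℝ) + 1) ^ (ρ - 2) := by
  -- From ‖V‖ ≤ 4M, ‖γ₁γ₂ - αβ‖ ≤ 2M² and ‖(α+β)(l+1) - αβ‖ ≤ (2M + M²)(l+1), over denominators of
  -- norm at least δ²(l+1)².
  set C1 : ℝ := (4 * M + 2 * M ^ 2) / δ ^ 2 with hC1
  set C2 : ℝ := (10 * M ^ 2 + 4 * M ^ 3) / δ ^ 2 with hC2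
  set C3 : ℝ := C2 + C1 ^ 2 / 2 with hC3
  set D : ℝ := ∑' l : ℕ, 1 / ((l : ℝ) + 1) ^ 2 with hD
  have hC10 : 0 ≤ C1 := by positivity
  have hC30 : 0 ≤ C3 := by positivity
  refine ⟨Real.exp (ρ + C3 * D) * (1 / δ ^ 2), fun α β γ₁ γ₂ hα hβ hγ₁ hγ₂ hα' hβ' hv m => ?_⟩
  have hfac : ∀ l : ℕ, ‖((l : ℂ) + 1 + γ₁) * (l + 1 + γ₂) / ((l + 1 - α) * (l + 1 - β))‖ ≤
      Real.exp (ρ * (1 / ((l : ℝ) + 1)) + C3 * (1 / ((l : ℝ) + 1) ^ 2)) := by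
    intro l
    have hL : (0 : ℝ) < (l : ℝ) + 1 := by positivity
    have hL1 : (1 : ℝ) ≤ (l : ℝ) + 1 := by linarith [Nat.cast_nonneg (α := ℝ) l]
    have hLc : ‖(l : ℂ) + 1‖ = (l : ℝ) + 1 := norm_natCast_add_one l
    have hL0 : (l : ℂ) + 1 ≠ 0 := by exact_mod_cast Nat.succ_ne_zero l
    have hA := mul_le_norm_sub hδ hα' l
    have hB := mul_le_norm_sub hδ hβ' l
    have hA0 : (l : ℂ) + 1 - α ≠ 0 := norm_pos_iff.1 (lt_of_lt_of_le (by positivity) hA)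
    have hB0 : (l : ℂ) + 1 - β ≠ 0 := norm_pos_iff.1 (lt_of_lt_of_le (by positivity) hB)
    have hAB : δ ^ 2 * ((l : ℝ) + 1) ^ 2 ≤ ‖((l : ℂ) + 1 - α) * (l + 1 - β)‖ := by
      rw [norm_mul]
      calc _ = (δ * ((l : ℝ) + 1)) * (δ * ((l : ℝ) + 1)) := by ring
        _ ≤ _ := mul_le_mul hA hB (by positivity) (norm_nonneg _)
    set V := α + β + γ₁ + γ₂ with hV
    set κ := γ₁ * γ₂ - α * β with hκ
    have hVn : ‖V‖ ≤ 4 * M := by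
      have := norm_add_le (α + β + γ₁) γ₂
      have := norm_add_le (α + β) γ₁
      have := norm_add_le α β
      linarith
    have hαβ : ‖α * β‖ ≤ M ^ 2 := by rw [norm_mul, sq]; gcongr
    have hγγ : ‖γ₁ * γ₂‖ ≤ M ^ 2 := by rw [norm_mul, sq]; gcongr
    have hκn : ‖κ‖ ≤ 2 * M ^ 2 := by
      have := norm_sub_le (γ₁ * γ₂) (α * β)
      linarith
    set z := (V * (l + 1) + κ) / (((l : ℂ) + 1 - α) * (l + 1 - β)) with hz
    have e1 : ((l : ℂ) + 1 + γ₁) * (l + 1 + γ₂) / ((l + 1 - α) * (l + 1 - β)) = 1 + z := by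
      rw [hz, hV, hκ]; field_simp; ring
    have e2 : z - V / (l + 1) = (κ * (l + 1) + V * ((α + β) * (l + 1) - α * β)) /
        ((l + 1) * (((l : ℂ) + 1 - α) * (l + 1 - β))) := by
      rw [hz]; field_simp; ring
    have hzn : ‖z‖ ≤ C1 / ((l : ℝ) + 1) := by
      rw [hz, norm_div]
      calc _ ≤ ((4 * M + 2 * M ^ 2) * ((l : ℝ) + 1)) / (δ ^ 2 * ((l : ℝ) + 1) ^ 2) := by
            refine div_le_div₀ (by positivity) ?_ (by positivity) hAB
            refine (norm_add_le _ _).trans ?_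
            rw [norm_mul, hLc]
            have : ‖V‖ * ((l : ℝ) + 1) ≤ 4 * M * ((l : ℝ) + 1) := by gcongr
            have : 2 * M ^ 2 ≤ 2 * M ^ 2 * ((l : ℝ) + 1) := le_mul_of_one_le_right (by positivity) hL1
            linarith
        _ = _ := by rw [hC1]; field_simp
    have hzV : ‖z - V / (l + 1)‖ ≤ C2 / ((l : ℝ) + 1) ^ 2 := by
      rw [e2, norm_div, norm_mul ((l : ℂ) + 1), hLc]
      calc _ ≤ ((10 * M ^ 2 + 4 * M ^ 3) * ((l : ℝ) + 1)) /
            (((l : ℝ) + 1) * (δ ^ 2 * ((l : ℝ) + 1) ^ 2)) := by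
            refine div_le_div₀ (by positivity) ?_ (by positivity) (by gcongr)
            refine (norm_add_le _ _).trans ?_
            rw [norm_mul, norm_mul, hLc]
            have h1 : ‖κ‖ * ((l : ℝ) + 1) ≤ 2 * M ^ 2 * ((l : ℝ) + 1) := by gcongr
            have h2 : ‖(α + β) * (l + 1) - α * β‖ ≤ (2 * M + M ^ 2) * ((l : ℝ) + 1) := by
              refine (norm_sub_le _ _).trans ?_
              rw [norm_mul, hLc]
              have h3 : ‖α + β‖ ≤ 2 * M := (norm_add_le _ _).trans (by linarith)
              have h4 : ‖α + β‖ * ((l : ℝ) + 1) ≤ 2 * M * ((l : ℝ) + 1) := by gcongr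
              have : M ^ 2 ≤ M ^ 2 * ((l : ℝ) + 1) := le_mul_of_one_le_right (by positivity) hL1
              linarith
            have h5 : ‖V‖ * ‖(α + β) * (l + 1) - α * β‖ ≤
                4 * M * ((2 * M + M ^ 2) * ((l : ℝ) + 1)) := by gcongr
            linarith
        _ = _ := by rw [hC2]; field_simp
    rw [e1]
    refine (norm_one_add_le_exp z).trans (Real.exp_le_exp.2 ?_)
    have hre : z.re ≤ V.re / ((l : ℝ) + 1) + C2 / ((l : ℝ) + 1) ^ 2 := by
      have h1 : (z - V / (l + 1)).re ≤ C2 / ((l : ℝ) + 1) ^ 2 := (Complex.re_le_norm _).trans hzV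
      have h2 : (V / ((l : ℂ) + 1)).re = V.re / ((l : ℝ) + 1) := by
        rw [show ((l : ℂ) + 1) = (((l : ℝ) + 1 : ℝ) : ℂ) by push_cast; rfl, Complex.div_ofReal_re]
      rw [Complex.sub_re, h2] at h1
      linarith
    have h3 : V.re / ((l : ℝ) + 1) ≤ ρ / ((l : ℝ) + 1) := by gcongr
    have h4 : ‖z‖ ^ 2 ≤ (C1 / ((l : ℝ) + 1)) ^ 2 := by gcongr
    calc _ ≤ ρ / ((l : ℝ) + 1) + C2 / ((l : ℝ) + 1) ^ 2 + (C1 / ((l : ℝ) + 1)) ^ 2 / 2 := by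
          linarith
      _ = _ := by rw [hC3]; generalize (l : ℝ) + 1 = L; ring
  have hprod : ‖∏ l ∈ range m, ((l : ℂ) + 1 + γ₁) * (l + 1 + γ₂) / ((l + 1 - α) * (l + 1 - β))‖ ≤
      Real.exp (ρ + C3 * D) * ((m : ℝ) + 1) ^ ρ := by
    rw [norm_prod]
    calc _ ≤ ∏ l ∈ range m, Real.exp (ρ * (1 / ((l : ℝ) + 1)) + C3 * (1 / ((l : ℝ) + 1) ^ 2)) :=
          prod_le_prod (fun _ _ => norm_nonneg _) fun l _ => hfac l
      _ = Real.exp (ρ * ∑ l ∈ range m, 1 / ((l : ℝ) + 1) +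
            C3 * ∑ l ∈ range m, 1 / ((l : ℝ) + 1) ^ 2) := by
          rw [← Real.exp_sum, sum_add_distrib, mul_sum, mul_sum]
      _ ≤ Real.exp (ρ * (1 + Real.log ((m : ℝ) + 1)) + C3 * D) := by
          refine Real.exp_le_exp.2 ?_
          gcongr
          · exact sum_range_inv_le m
          · exact summable_one_div_add_one_sq.sum_le_tsum _ fun _ _ => by positivity
      _ = _ := by
          rw [Real.rpow_def_of_pos (by positivity), ← Real.exp_add]
          congr 1; ring
  have hA := mul_le_norm_sub hδ hα' m
  have hB := mul_le_norm_sub hδ hβ' m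
  have hm : (0 : ℝ) < (m : ℝ) + 1 := by positivity
  have hlast : ‖1 / (((m : ℂ) + 1 - α) * (m + 1 - β))‖ ≤ 1 / δ ^ 2 * ((m : ℝ) + 1) ^ (-2 : ℝ) := by
    rw [norm_div, norm_one, norm_mul, Real.rpow_neg hm.le, Real.rpow_two]
    calc _ ≤ 1 / ((δ * ((m : ℝ) + 1)) * (δ * ((m : ℝ) + 1))) := by
          refine one_div_le_one_div_of_le (by positivity) ?_
          gcongr
      _ = _ := by field_simp
  rw [prodTerm, norm_mul]
  calc _ ≤ (Real.exp (ρ + C3 * D) * ((m : ℝ) + 1) ^ ρ) * (1 / δ ^ 2 * ((m : ℝ) + 1) ^ (-2 : ℝ)) :=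
        mul_le_mul hprod hlast (norm_nonneg _) (by positivity)
    _ = _ := by rw [sub_eq_add_neg, Real.rpow_add hm]; ring

lemma summable_rpow_add_one {ρ : ℝ} (hρ : ρ < 1) :
    Summable fun m : ℕ => ((m : ℝ) + 1) ^ (ρ - 2) := by
  have h := (summable_nat_add_iff 1).2 (Real.summable_nat_rpow.2 (show ρ - 2 < -1 by linarith))
  exact_mod_cast h

/-- The parameters are homogeneous of degree one, so scaling them along the ray avoids any choice of
branch for the roots. -/
lemma IsParam.smul {t u v w α β γ₁ γ₂ : ℂ} (hp : IsParam t u v w α β γ₁ γ₂) (x : ℂ) :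
    IsParam t (x * u) (x * v) (x * w) (x * α) (x * β) (x * γ₁) (x * γ₂) where
  add := by linear_combination x * hp.add
  mul := by linear_combination x ^ 2 * hp.mul
  add' := by linear_combination x * hp.add'
  mul' := by linear_combination x ^ 2 * hp.mul'

lemma IsParam.sum_eq {t u v w α β γ₁ γ₂ : ℂ} (hp : IsParam t u v w α β γ₁ γ₂) :
    α + β + γ₁ + γ₂ = v := by linear_combination hp.add + hp.add'

/-- The total degree is (k-n-s) + (n-s) + (2s-2) = k - 2. Absolute convergence at x = 1 therefore
dominates the series on the whole closed unit disc. -/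
lemma Φ₀Term_smul (t u v w x : ℂ) (q : Triples) :
    Φ₀Term t (x * u) (x * v) (x * w) q = x ^ (q.1.1 - 2) * Φ₀Term t u v w q := by
  obtain ⟨⟨k, n, s⟩, h1, h2, h3⟩ := q
  dsimp only at h1 h2 h3
  simp only [Φ₀Term, mul_pow]
  rw [show k - 2 = (k - n - s) + (n - s) + (2 * s - 2) by omega, pow_add, pow_add]
  ring

lemma summable_prodTerm {α β γ₁ γ₂ : ℂ} (hα : α.re < 1) (hβ : β.re < 1)
    (hv : (α + β + γ₁ + γ₂).re < 1) : Summable (prodTerm α β γ₁ γ₂) := by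
  set M := ‖α‖ + ‖β‖ + ‖γ₁‖ + ‖γ₂‖ with hM
  have n1 := norm_nonneg α
  have n2 := norm_nonneg β
  have n3 := norm_nonneg γ₁
  have n4 := norm_nonneg γ₂
  set δ := min 1 (min (1 - α.re) (1 - β.re)) with hδ
  have hδ0 : 0 < δ := lt_min one_pos (lt_min (by linarith) (by linarith))
  have hδα : δ ≤ 1 - α.re := (min_le_right _ _).trans (min_le_left _ _)
  have hδβ : δ ≤ 1 - β.re := (min_le_right _ _).trans (min_le_right _ _)
  set ρ := max 0 (α + β + γ₁ + γ₂).re with hρ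
  obtain ⟨C, hC⟩ := prodTerm_bound (M := M) (by positivity) hδ0 (min_le_left _ _)
    (le_max_left 0 (α + β + γ₁ + γ₂).re)
  exact Summable.of_norm_bounded ((summable_rpow_add_one (max_lt one_pos hv)).mul_left C)
    (hC α β γ₁ γ₂ (by linarith) (by linarith) (by linarith) (by linarith) (by linarith)
      (by linarith) (le_max_right _ _))

/-- The identity principle along the ray through `(u, v, w)`. -/
theorem tsum_Φ₀Term_eq {t u v w α β γ₁ γ₂ : ℂ} (hp : IsParam t u v w α β γ₁ γ₂)
    (hα : α.re < 1) (hβ : β.re < 1) (hv : v.re < 1) (hs : Summable (Φ₀Term t u v w)) :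
    Φ₀ t u v w = ∑' m, prodTerm α β γ₁ γ₂ m := by
  have n1 := norm_nonneg α
  have n2 := norm_nonneg β
  have n3 := norm_nonneg γ₁
  have n4 := norm_nonneg γ₂
  -- The factor 2 covers the dilations ‖x‖ ≤ 2; halving δ below puts x = 1 in the interior of the
  -- region.
  set M := 2 * (‖α‖ + ‖β‖ + ‖γ₁‖ + ‖γ₂‖) with hM
  set δ := min 1 (min (1 - α.re) (1 - β.re)) / 2 with hδ
  have hδ1 : 0 < min 1 (min (1 - α.re) (1 - β.re)) :=
    lt_min one_pos (lt_min (by linarith) (by linarith))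
  have hδ11 : min 1 (min (1 - α.re) (1 - β.re)) ≤ 1 := min_le_left _ _
  have hδ0 : 0 < δ := by positivity
  have hδα : 2 * δ ≤ 1 - α.re := by
    rw [hδ, mul_div_cancel₀ _ two_ne_zero]
    exact (min_le_right _ _).trans (min_le_left _ _)
  have hδβ : 2 * δ ≤ 1 - β.re := by
    rw [hδ, mul_div_cancel₀ _ two_ne_zero]
    exact (min_le_right _ _).trans (min_le_right _ _)
  have hδ2 : 2 * δ ≤ 1 := by rw [hδ, mul_div_cancel₀ _ two_ne_zero]; exact hδ11
  -- ρ > 0 keeps x = 0 in the region, ρ > Re v keeps x = 1 in it, and ρ < 1 makes the majorant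
  -- summable.
  obtain ⟨ρ, hρ, hρ1⟩ := exists_between (max_lt one_pos hv)
  have hρ0 : 0 < ρ := (le_max_left _ _).trans_lt hρ
  have hρv : v.re < ρ := (le_max_right _ _).trans_lt hρ
  obtain ⟨C, hC⟩ := prodTerm_bound (M := M) (by positivity) hδ0 (by linarith) hρ0.le
  -- the region of analyticity
  set U : Set ℂ := Metric.ball 0 2 ∩ ({x | (x * α).re < 1 - δ} ∩
    ({x | (x * β).re < 1 - δ} ∩ {x | (x * v).re < ρ})) with hU
  have hlin : ∀ (a : ℂ) (r : ℝ), IsOpen {x : ℂ | (x * a).re < r} ∧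
      Convex ℝ {x : ℂ | (x * a).re < r} := by
    intro a r
    refine ⟨isOpen_lt (by fun_prop) continuous_const, ?_⟩
    exact convex_halfSpace_lt (f := fun x : ℂ => (x * a).re)
      ⟨fun x y => by rw [add_mul, Complex.add_re], fun c x => by simp; ring⟩ r
  have hUo : IsOpen U := Metric.isOpen_ball.inter
    ((hlin α _).1.inter ((hlin β _).1.inter (hlin v _).1))
  have hUc : Convex ℝ U := (convex_ball 0 2).inter
    ((hlin α _).2.inter ((hlin β _).2.inter (hlin v _).2))
  have hIcc : ∀ y : ℝ, 0 ≤ y → y ≤ 1 → (y : ℂ) ∈ U := by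
    intro y h0 h1
    have key : ∀ c r : ℝ, 0 < r → c < r → y * c < r := by
      intro c r hr hc
      rcases le_or_gt c 0 with h | h
      · nlinarith
      · nlinarith
    refine ⟨?_, ?_, ?_, ?_⟩
    · simp only [Metric.mem_ball, dist_zero_right, Complex.norm_real, Real.norm_eq_abs]
      rw [abs_of_nonneg h0]; linarith
    · simp only [Set.mem_ofPred_eq, Complex.re_ofReal_mul]
      exact key _ _ (by linarith) (by linarith)
    · simp only [Set.mem_ofPred_eq, Complex.re_ofReal_mul]
      exact key _ _ (by linarith) (by linarith)
    · simp only [Set.mem_ofPred_eq, Complex.re_ofReal_mul]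
      exact key _ _ hρ0 hρv
  set G : ℂ → ℂ := fun x => ∑' m, prodTerm (x * α) (x * β) (x * γ₁) (x * γ₂) m with hG
  have hne : ∀ a x : ℂ, (x * a).re < 1 - δ → ∀ l : ℕ, (l : ℂ) + 1 - x * a ≠ 0 := by
    intro a x hx l
    exact norm_pos_iff.1 (lt_of_lt_of_le (by positivity)
      (mul_le_norm_sub (by linarith) hx.le l))
  have hGd : DifferentiableOn ℂ G U := by
    refine Complex.differentiableOn_tsum_of_summable_norm
      ((summable_rpow_add_one hρ1).mul_left C) (fun m => ?_) hUo (fun m x hx => ?_)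
    · intro x hx
      have hxα := hne α x hx.2.1
      have hxβ := hne β x hx.2.2.1
      refine DifferentiableAt.differentiableWithinAt ?_
      unfold prodTerm
      refine DifferentiableAt.mul (DifferentiableAt.fun_finsetProd fun l _ => ?_) ?_
      · exact DifferentiableAt.div (by fun_prop) (by fun_prop) (mul_ne_zero (hxα l) (hxβ l))
      · exact DifferentiableAt.div (by fun_prop) (by fun_prop) (mul_ne_zero (hxα m) (hxβ m))
    · have h2 : ‖x‖ ≤ 2 := by simpa using (Metric.mem_ball.1 hx.1).le
      have hn : ∀ a : ℂ, ‖a‖ ≤ ‖α‖ + ‖β‖ + ‖γ₁‖ + ‖γ₂‖ → ‖x * a‖ ≤ M := fun a ha => by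
        rw [norm_mul, hM]; gcongr
      refine hC _ _ _ _ (hn _ (by linarith)) (hn _ (by linarith)) (hn _ (by linarith))
        (hn _ (by linarith)) (le_of_lt hx.2.1) (le_of_lt hx.2.2.1) ?_ m
      rw [(hp.smul x).sum_eq]
      exact le_of_lt hx.2.2.2
  set F : ℂ → ℂ := fun x => ∑' q, Φ₀Term t (x * u) (x * v) (x * w) q with hF
  have hFb : ∀ (q : Triples) (x : ℂ), ‖x‖ ≤ 1 →
      ‖Φ₀Term t (x * u) (x * v) (x * w) q‖ ≤ ‖Φ₀Term t u v w q‖ := by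
    intro q x hx
    rw [Φ₀Term_smul, norm_mul, norm_pow]
    exact mul_le_of_le_one_left (norm_nonneg _) (pow_le_one₀ (norm_nonneg _) hx)
  have hFd : DifferentiableOn ℂ F (Metric.ball 0 1) := by
    refine Complex.differentiableOn_tsum_of_summable_norm hs.norm (fun q => ?_)
      Metric.isOpen_ball (fun q x hx => hFb q x (by simpa using (Metric.mem_ball.1 hx).le))
    unfold Φ₀Term
    fun_prop
  -- x = 1 lies on the boundary of the disc where F is known to be analytic, so equality there comes
  -- from continuity.
  have hFc : ContinuousOn F (Metric.closedBall 0 1) := by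
    refine continuousOn_tsum (fun q => ?_) hs.norm
      (fun q x hx => hFb q x (by simpa using hx))
    unfold Φ₀Term
    fun_prop
  -- equality near the origin
  obtain ⟨r, hr, hr'⟩ := exists_radius t
  have hFG : F =ᶠ[𝓝 0] G := by
    have h0 : ∀ a : ℂ, ∀ᶠ x : ℂ in 𝓝 0, ‖x * a‖ < r := fun a => by
      have : Tendsto (fun x : ℂ => ‖x * a‖) (𝓝 0) (𝓝 ‖(0 : ℂ) * a‖) :=
        Continuous.tendsto (by fun_prop) 0
      rw [zero_mul, norm_zero] at this
      exact this.eventually_lt_const hr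
    filter_upwards [h0 u, h0 v, h0 w] with x hu hv hw
    obtain ⟨h1, h2, h3⟩ := hr' _ _ _ hu hv hw
    exact (hasSum_Φ₀Term_prodTerm (hp.smul x) h1 h2 h3).tsum_eq
  set W : Set ℂ := Metric.ball 0 1 ∩ U with hW
  have hWo : IsOpen W := Metric.isOpen_ball.inter hUo
  have hWp : IsPreconnected W := ((convex_ball 0 1).inter hUc).isPreconnected
  have h0W : (0 : ℂ) ∈ W := ⟨by simp, by simpa using hIcc 0 le_rfl zero_le_one⟩
  have hEq : Set.EqOn F G W :=
    ((hFd.mono Set.inter_subset_left).analyticOnNhd hWo).eqOn_of_preconnected_of_eventuallyEq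
      ((hGd.mono Set.inter_subset_right).analyticOnNhd hWo) hWp h0W hFG
  -- the limit at `1`
  have hT : Tendsto (fun y : ℝ => (y : ℂ)) (𝓝[<] 1) (𝓝 1) := by
    have : Tendsto (fun y : ℝ => (y : ℂ)) (𝓝 1) (𝓝 ((1 : ℝ) : ℂ)) :=
      Complex.continuous_ofReal.tendsto 1
    rw [Complex.ofReal_one] at this
    exact this.mono_left nhdsWithin_le_nhds
  have hmem : ∀ᶠ y : ℝ in 𝓝[<] 1, 0 ≤ y ∧ y < 1 := by
    filter_upwards [self_mem_nhdsWithin, nhdsWithin_le_nhds (lt_mem_nhds one_pos)] with y h1 h2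
    exact ⟨h2.le, h1⟩
  have hFt : Tendsto (fun y : ℝ => F y) (𝓝[<] 1) (𝓝 (F 1)) := by
    refine (hFc 1 (by simp)).tendsto.comp (tendsto_nhdsWithin_iff.2 ⟨hT, ?_⟩)
    filter_upwards [hmem] with y hy
    simp [abs_of_nonneg hy.1, hy.2.le]
  have h1U : (1 : ℂ) ∈ U := by simpa using hIcc 1 zero_le_one le_rfl
  have hGt : Tendsto (fun y : ℝ => G y) (𝓝[<] 1) (𝓝 (G 1)) :=
    ((hGd.continuousOn.continuousAt (hUo.mem_nhds h1U)).tendsto).comp hT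
  have hEv : (fun y : ℝ => F y) =ᶠ[𝓝[<] 1] fun y : ℝ => G y := by
    filter_upwards [hmem] with y hy
    exact hEq ⟨by simp [abs_of_nonneg hy.1, hy.2], hIcc y hy.1 hy.2.le⟩
  have := tendsto_nhds_unique (hFt.congr' hEv) hGt
  simpa [hF, hG, Φ₀] using this

/-! ### Rising factorials and Gauss's summation theorem -/

/-- The rising factorial `s (s + 1) ⋯ (s + n - 1)`. -/
noncomputable def poch (s : ℂ) (n : ℕ) : ℂ := ∏ j ∈ range n, (s + j)

@[simp] lemma poch_zero (s : ℂ) : poch s 0 = 1 := rfl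

lemma poch_succ (s : ℂ) (n : ℕ) : poch s (n + 1) = poch s n * (s + n) := prod_range_succ _ _

lemma poch_succ' (s : ℂ) (n : ℕ) : poch s (n + 1) = s * poch (s + 1) n := by
  rw [poch, prod_range_succ', mul_comm, poch]
  congr 1
  · simp
  · exact prod_congr rfl fun j _ => by push_cast; ring

lemma poch_eq_eval (s : ℂ) (n : ℕ) : poch s n = (ascPochhammer ℂ n).eval s := by
  induction n with
  | zero => simp
  | succ n ih => rw [poch_succ, ih, ascPochhammer_succ_eval]

lemma poch_one (n : ℕ) : poch 1 n = n.factorial := by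
  induction n with
  | zero => simp
  | succ n ih => rw [poch_succ, ih, Nat.factorial_succ]; push_cast; ring

lemma poch_ne_zero {s : ℂ} (hs : ∀ m : ℕ, s ≠ -m) (n : ℕ) : poch s n ≠ 0 :=
  prod_ne_zero_iff.2 fun j _ h => hs j (eq_neg_of_add_eq_zero_left h)

lemma ne_neg_nat_of_re_pos {s : ℂ} (hs : 0 < s.re) (m : ℕ) : s ≠ -m := by
  rintro rfl
  simp only [Complex.neg_re, Complex.natCast_re] at hs
  linarith [Nat.cast_nonneg (α := ℝ) m]

lemma Gamma_add_nat {s : ℂ} (hs : ∀ m : ℕ, s ≠ -m) (n : ℕ) :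
    Complex.Gamma (s + n) = poch s n * Complex.Gamma s := by
  induction n with
  | zero => simp
  | succ n ih =>
    have : s + n ≠ 0 := fun h => hs n (eq_neg_of_add_eq_zero_left h)
    rw [Nat.cast_succ, ← add_assoc, Complex.Gamma_add_one _ this, ih, poch_succ]
    ring

/-- The reciprocal of Euler's limit for Γ. At a pole s = -m the product is eventually 0, in
agreement with the convention Γ(-m) = 0, 1/0 = 0. -/
lemma tendsto_poch (s : ℂ) :
    Tendsto (fun n : ℕ => poch s (n + 1) / ((n : ℂ) ^ s * n.factorial)) atTop
      (𝓝 (1 / Complex.Gamma s)) := by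
  by_cases hs : ∃ m : ℕ, s = -m
  · obtain ⟨m, rfl⟩ := hs
    rw [Complex.Gamma_neg_nat_eq_zero, div_zero]
    refine tendsto_const_nhds.congr' ?_
    filter_upwards [eventually_ge_atTop m] with n hn
    rw [poch, prod_eq_zero (i := m) (by simp; omega) (by simp), zero_div]
  · push Not at hs
    have h := (Complex.GammaSeq_tendsto_Gamma s).inv₀ (Complex.Gamma_ne_zero hs)
    rw [one_div]
    refine h.congr fun n => ?_
    rw [Complex.GammaSeq, inv_div]
    rfl

lemma tendsto_shift_cpow (x : ℂ) :
    Tendsto (fun n : ℕ => ((n : ℂ) + 1) ^ x / (n : ℂ) ^ x) atTop (𝓝 1) := by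
  have h1 : Tendsto (fun n : ℕ => (1 : ℂ) + 1 / (n : ℂ)) atTop (𝓝 1) := by
    simpa using (tendsto_const_nhds (x := (1 : ℂ))).add tendsto_one_div_atTop_nhds_zero_nat
  have h2 : Tendsto (fun n : ℕ => ((1 : ℂ) + 1 / (n : ℂ)) ^ x) atTop (𝓝 1) := by
    have := (continuousAt_cpow_const (a := 1) (b := x) (by simp)).tendsto.comp h1
    simpa [Function.comp_def] using this
  refine h2.congr' ?_
  filter_upwards [eventually_gt_atTop 0] with n hn
  have hn' : (n : ℂ) ≠ 0 := by exact_mod_cast hn.ne'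
  rw [eq_div_iff (by simp [Complex.cpow_eq_zero_iff, hn']), mul_comm]
  have := Complex.mul_cpow_ofReal_nonneg (a := n) (b := 1 + 1 / n) (by positivity) (by positivity) x
  push_cast at this
  rw [← this]
  congr 1
  field_simp

lemma tendsto_poch_div (s s' : ℂ) (hs' : ∀ m : ℕ, s' ≠ -m) :
    Tendsto (fun n : ℕ => poch s n / poch s' n * (n : ℂ) ^ (s' - s)) atTop
      (𝓝 (Complex.Gamma s' / Complex.Gamma s)) := by
  rw [← tendsto_add_atTop_iff_nat 1]
  have h := ((tendsto_poch s).div (tendsto_poch s')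
    (one_div_ne_zero (Complex.Gamma_ne_zero hs'))).mul (tendsto_shift_cpow (s' - s))
  rw [mul_one, div_div_div_eq, one_mul, mul_one] at h
  refine h.congr' ?_
  filter_upwards [eventually_gt_atTop 0] with n hn
  have hn' : (n : ℂ) ≠ 0 := by exact_mod_cast hn.ne'
  have h1 : ∀ x : ℂ, (n : ℂ) ^ x ≠ 0 := fun x => by simp [Complex.cpow_eq_zero_iff, hn']
  have h2 : (n.factorial : ℂ) ≠ 0 := by exact_mod_cast n.factorial_ne_zero
  have h3 := poch_ne_zero hs' (n + 1)
  have h4 := h1 s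
  have h5 := h1 s'
  simp only [Pi.div_apply]
  rw [Complex.cpow_sub _ _ hn']
  push_cast
  field_simp

/-- The coefficients of the Gauss hypergeometric series. -/
noncomputable def hypCoeff (a b c : ℂ) (n : ℕ) : ℂ :=
  poch a n * poch b n / (poch 1 n * poch c n)

lemma hypCoeff_succ (a b c : ℂ) (n : ℕ) :
    hypCoeff a b c (n + 1) = hypCoeff a b c n * ((a + n) * (b + n) / ((1 + n) * (c + n))) := by
  rw [hypCoeff, hypCoeff, div_mul_div_comm, poch_succ, poch_succ, poch_succ, poch_succ]
  congr 1 <;> ring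

lemma tendsto_hypCoeff (a b c : ℂ) (hc : ∀ m : ℕ, c ≠ -m) :
    Tendsto (fun n : ℕ => hypCoeff a b c n * (n : ℂ) ^ (c - a - b + 1)) atTop
      (𝓝 (Complex.Gamma c / (Complex.Gamma a * Complex.Gamma b))) := by
  have h := (tendsto_poch_div a 1 (ne_neg_nat_of_re_pos (by simp))).mul (tendsto_poch_div b c hc)
  rw [Complex.Gamma_one, div_mul_div_comm, one_mul] at h
  refine h.congr' ?_
  filter_upwards [eventually_gt_atTop 0] with n hn
  have hn' : (n : ℂ) ≠ 0 := by exact_mod_cast hn.ne'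
  rw [show c - a - b + 1 = (1 - a) + (c - b) by ring, Complex.cpow_add _ _ hn', hypCoeff]
  ring

lemma summable_norm_hypCoeff (a b c : ℂ) (hc : ∀ m : ℕ, c ≠ -m) (h : 0 < (c - a - b).re) :
    Summable fun n => ‖hypCoeff a b c n‖ := by
  refine summable_of_isBigO_nat (g := fun n : ℕ => (n : ℝ) ^ (-((c - a - b).re + 1)))
    (Real.summable_nat_rpow.2 (by linarith)) ?_
  have h1 := (tendsto_hypCoeff a b c hc).isBigO_one ℝ
  have h2 : (fun n : ℕ => ((n : ℂ) ^ (c - a - b + 1))⁻¹) =O[atTop]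
      fun n : ℕ => (n : ℝ) ^ (-((c - a - b).re + 1)) := by
    refine Asymptotics.IsBigO.of_bound 1 ?_
    filter_upwards [eventually_gt_atTop 0] with n hn
    rw [norm_inv, Complex.norm_natCast_cpow_of_pos hn, Real.rpow_neg (by positivity), one_mul,
      Complex.add_re, Complex.one_re]
    exact le_abs_self _
  refine Asymptotics.IsBigO.norm_left ((h1.mul h2).congr' ?_ ?_)
  · filter_upwards [eventually_gt_atTop 0] with n hn
    have hn' : (n : ℂ) ≠ 0 := by exact_mod_cast hn.ne'
    rw [mul_inv_cancel_right₀ (by simp [Complex.cpow_eq_zero_iff, hn'])]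
  · filter_upwards with n
    rw [one_mul]

lemma tsum_of_telescope {f g : ℕ → ℂ} (hf : Summable f) {l : ℂ} (h : ∀ n, f n = g (n + 1) - g n)
    (hg : Tendsto g atTop (𝓝 l)) : ∑' n, f n = l - g 0 := by
  refine tendsto_nhds_unique hf.hasSum.tendsto_sum_nat ?_
  have : ∀ n, ∑ i ∈ range n, f i = g n - g 0 := fun n => by
    rw [sum_congr rfl fun i _ => h i, sum_range_sub]
  simp_rw [this]
  exact hg.sub_const _

lemma tendsto_nat_cpow_neg {x : ℂ} (hx : x.re < 0) :
    Tendsto (fun n : ℕ => (n : ℂ) ^ x) atTop (𝓝 0) := by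
  rw [tendsto_zero_iff_norm_tendsto_zero]
  have h := (tendsto_rpow_neg_atTop (y := -x.re) (by linarith)).comp tendsto_natCast_atTop_atTop
  refine h.congr' ?_
  filter_upwards [eventually_gt_atTop 0] with n hn
  rw [Complex.norm_natCast_cpow_of_pos hn]
  simp

/-- The difference of the two summands telescopes with g(n) = -c n · `hypCoeff a b c n`, which tends
to 0 because the coefficients decay like n^(-(c-a-b)-1). -/
lemma gauss_step (a b c : ℂ) (hc : ∀ m : ℕ, c ≠ -m) (h : 0 < (c - a - b).re) :
    c * (c - a - b) * ∑' n, hypCoeff a b c n =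
      (c - a) * (c - b) * ∑' n, hypCoeff a b (c + 1) n := by
  have hc1 : ∀ m : ℕ, c + 1 ≠ -m := fun m hm => hc (m + 1) (by push_cast; linear_combination hm)
  have hs := (summable_norm_hypCoeff a b c hc h).of_norm
  have hs1 := (summable_norm_hypCoeff a b (c + 1) hc1 (by
    have : (c + 1 - a - b).re = (c - a - b).re + 1 := by simp; ring
    linarith)).of_norm
  have hcn : ∀ n : ℕ, c + n ≠ 0 := fun n h => hc n (eq_neg_of_add_eq_zero_left h)
  have hrel : ∀ n, hypCoeff a b (c + 1) n = hypCoeff a b c n * (c / (c + n)) := by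
    intro n
    have e : c * poch (c + 1) n = poch c n * (c + n) := by rw [← poch_succ', poch_succ]
    have h0 : c ≠ 0 := by simpa using hc 0
    have h1 := poch_ne_zero hc n
    have h2 := poch_ne_zero hc1 n
    have h3 := hcn n
    have h4 : poch 1 n ≠ 0 := poch_ne_zero (ne_neg_nat_of_re_pos (by simp)) n
    rw [hypCoeff, hypCoeff]
    field_simp
    linear_combination (-poch a n * poch b n) * e
  have key := tsum_of_telescope (f := fun n => c * (c - a - b) * hypCoeff a b c n -
      (c - a) * (c - b) * hypCoeff a b (c + 1) n)
    (g := fun n => -c * (n * hypCoeff a b c n)) (l := -c * 0)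
    ((hs.mul_left _).sub (hs1.mul_left _)) (fun n => ?_) (Tendsto.const_mul _ ?_)
  · rw [Summable.tsum_sub (hs.mul_left _) (hs1.mul_left _), tsum_mul_left, tsum_mul_left] at key
    simp only [Nat.cast_zero, zero_mul, mul_zero, sub_self] at key
    exact sub_eq_zero.1 key
  · rw [hrel, hypCoeff_succ]
    have h3 := hcn n
    have h5 : (1 : ℂ) + n ≠ 0 := by
      rw [add_comm]; exact_mod_cast Nat.succ_ne_zero n
    push_cast
    field_simp
    ring
  · have h1 := (tendsto_hypCoeff a b c hc).mul
      (tendsto_nat_cpow_neg (x := -(c - a - b)) (by rw [Complex.neg_re]; linarith))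
    rw [mul_zero] at h1
    refine h1.congr' ?_
    filter_upwards [eventually_gt_atTop 0] with n hn
    have hn' : (n : ℂ) ≠ 0 := by exact_mod_cast hn.ne'
    rw [mul_assoc, ← Complex.cpow_add _ _ hn', show c - a - b + 1 + -(c - a - b) = 1 by ring,
      Complex.cpow_one, mul_comm]

lemma tendsto_inv_add_nat (x : ℂ) : Tendsto (fun N : ℕ => (x + N)⁻¹) atTop (𝓝 0) := by
  refine tendsto_inv₀_cobounded.comp (tendsto_norm_atTop_iff_cobounded.1 ?_)
  refine tendsto_atTop_mono (f := fun N : ℕ => (N : ℝ) - ‖x‖) (fun N => ?_)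
    (tendsto_atTop_add_const_right _ _ tendsto_natCast_atTop_atTop)
  have := norm_sub_le (x + N) x
  rw [add_sub_cancel_left, Complex.norm_natCast] at this
  linarith

/-- All terms but the zeroth tend to 0. For N ≥ N₀ they are dominated by the coefficients at the
positive real c' = Re c + N₀, since |c + N + j| ≥ c' + j. -/
lemma tendsto_gauss_shift (a b c : ℂ) (h : 0 < (c - a - b).re) :
    Tendsto (fun N : ℕ => ∑' n, hypCoeff a b (c + N) n) atTop (𝓝 1) := by
  obtain ⟨N₀, hN₀⟩ := exists_nat_gt (-c.re)
  set c' : ℂ := ((c.re + N₀ : ℝ) : ℂ) with hc'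
  have hc'0 : 0 < c'.re := by rw [hc', Complex.ofReal_re]; linarith
  have hs := summable_norm_hypCoeff a b c' (ne_neg_nat_of_re_pos hc'0) (by
    simp only [Complex.sub_re, hc', Complex.ofReal_re] at h ⊢
    linarith [Nat.cast_nonneg (α := ℝ) N₀])
  have hlim : ∑' n : ℕ, poch a n * poch b n / poch 1 n * ∏ _j ∈ range n, (0 : ℂ) = 1 := by
    rw [tsum_eq_single 0 fun n hn => by simp [hn]]
    simp
  rw [← hlim]
  refine tendsto_tsum_of_dominated_convergence hs (fun n => ?_) ?_
  · have h1 : ∀ N : ℕ, hypCoeff a b (c + N) n =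
        poch a n * poch b n / poch 1 n * ∏ j ∈ range n, (c + j + N)⁻¹ := by
      intro N
      rw [hypCoeff, poch, poch, poch, poch, prod_inv_distrib, ← div_div, div_eq_mul_inv _ (∏ j ∈ _, _)]
      congr 2
      exact prod_congr rfl fun j _ => by ring
    simp_rw [h1]
    exact (tendsto_finsetProd _ fun j _ => tendsto_inv_add_nat _).const_mul _
  · filter_upwards [eventually_ge_atTop N₀] with N hN n
    have hN' : (N₀ : ℝ) ≤ N := by exact_mod_cast hN
    rw [hypCoeff, hypCoeff, norm_div, norm_div, norm_mul (poch 1 n), norm_mul (poch 1 n)]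
    have h1 : 0 < ‖poch 1 n‖ :=
      norm_pos_iff.2 (poch_ne_zero (ne_neg_nat_of_re_pos (by simp)) n)
    have h2 : 0 < ‖poch c' n‖ := norm_pos_iff.2 (poch_ne_zero (ne_neg_nat_of_re_pos hc'0) n)
    gcongr
    rw [poch, poch, norm_prod, norm_prod]
    refine prod_le_prod (fun _ _ => norm_nonneg _) fun j _ => ?_
    have hj := Nat.cast_nonneg (α := ℝ) j
    have e1 : ‖c' + j‖ = c.re + N₀ + j := by
      rw [hc', ← Complex.ofReal_natCast, ← Complex.ofReal_add, Complex.norm_real,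
        Real.norm_of_nonneg (by linarith)]
    rw [e1]
    refine le_trans ?_ (Complex.re_le_norm _)
    simp only [Complex.add_re, Complex.natCast_re]
    linarith

/-- Gauss's summation theorem. -/
theorem tsum_hypCoeff (a b c : ℂ) (hc : ∀ m : ℕ, c ≠ -m) (h : 0 < (c - a - b).re) :
    ∑' n, hypCoeff a b c n = Complex.Gamma c * Complex.Gamma (c - a - b) /
      (Complex.Gamma (c - a) * Complex.Gamma (c - b)) := by
  have hcab := ne_neg_nat_of_re_pos h
  -- N contiguous steps c → c + 1. As N → ∞ the shifted series tends to 1 and the rising factorials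
  -- produce the Gamma quotient.
  have hstep : ∀ N : ℕ, poch c N * poch (c - a - b) N * ∑' n, hypCoeff a b c n =
      poch (c - a) N * poch (c - b) N * ∑' n, hypCoeff a b (c + N) n := by
    intro N
    induction N with
    | zero => simp
    | succ N ih =>
      have hcN : ∀ m : ℕ, c + N ≠ -m := fun m hm =>
        hc (m + N) (by push_cast; linear_combination hm)
      have hg := gauss_step a b (c + N) hcN (by
        have : (c + N - a - b).re = (c - a - b).re + N := by simp; ring
        rw [this]; positivity)
      rw [poch_succ, poch_succ, poch_succ, poch_succ, Nat.cast_succ, ← add_assoc]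
      linear_combination (c + N) * (c - a - b + N) * ih + poch (c - a) N * poch (c - b) N * hg
  have h1 := ((tendsto_poch_div (c - a) c hc).mul (tendsto_poch_div (c - b) (c - a - b) hcab)).mul
    (tendsto_gauss_shift a b c h)
  rw [mul_one, div_mul_div_comm] at h1
  refine tendsto_nhds_unique (tendsto_const_nhds.congr' ?_) h1
  filter_upwards [eventually_gt_atTop 0] with N hN
  have hn' : (N : ℂ) ≠ 0 := by exact_mod_cast hN.ne'
  have h2 := poch_ne_zero hc N
  have h3 := poch_ne_zero hcab N
  have h4 : (N : ℂ) ^ (c - (c - a)) * (N : ℂ) ^ (c - a - b - (c - b)) = 1 := by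
    rw [← Complex.cpow_add _ _ hn', show c - (c - a) + (c - a - b - (c - b)) = 0 by ring,
      Complex.cpow_zero]
  have h5 := hstep N
  calc _ = (poch c N * poch (c - a - b) N * ∑' n, hypCoeff a b c n) /
        (poch c N * poch (c - a - b) N) := by field_simp
    _ = (poch (c - a) N * poch (c - b) N * ∑' n, hypCoeff a b (c + N) n) /
        (poch c N * poch (c - a - b) N) * ((N : ℂ) ^ (c - (c - a)) *
          (N : ℂ) ^ (c - a - b - (c - b))) := by rw [h5, h4, mul_one]
    _ = _ := by field_simp

/-! ### Mellin sums: difference equation and asymptotics -/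

/-- Normalised Beta values: `betaRatio α v N = Γ(N + 1 - α) / Γ(N + 1 - α + v)`. -/
noncomputable def betaRatio (α v : ℂ) (N : ℕ) : ℂ :=
  Complex.Gamma (1 - α) / Complex.Gamma (1 - α + v) * (poch (1 - α) N / poch (1 - α + v) N)

/-- The Mellin transform of `(1 - z) ^ (v - 1) F(a, b; c; z)` at `M + 1 - α`, over `Γ(v)`. -/
noncomputable def mellinSum (α v a b c : ℂ) (M : ℕ) : ℂ :=
  ∑' n, hypCoeff a b c n * betaRatio α v (n + M)

lemma tendsto_betaRatio {α v : ℂ} (hα : α.re < 1) (hv : 0 < v.re) :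
    Tendsto (fun N : ℕ => betaRatio α v N * (N : ℂ) ^ v) atTop (𝓝 1) := by
  have h0 : ∀ m : ℕ, 1 - α ≠ -m := ne_neg_nat_of_re_pos (by simp; linarith)
  have h1 : ∀ m : ℕ, 1 - α + v ≠ -m := ne_neg_nat_of_re_pos (by simp; linarith)
  have h := (tendsto_poch_div (1 - α) (1 - α + v) h1).const_mul
    (Complex.Gamma (1 - α) / Complex.Gamma (1 - α + v))
  have g0 := Complex.Gamma_ne_zero h0
  have g1 := Complex.Gamma_ne_zero h1
  rw [div_mul_div_cancel₀ g1, div_self g0] at h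
  refine h.congr fun N => ?_
  rw [betaRatio, add_sub_cancel_left, mul_assoc]

lemma betaRatio_succ {α v : ℂ} (hα : α.re < 1) (hv : 0 < v.re) (N : ℕ) :
    betaRatio α v (N + 1) * (N + 1 - α + v) = betaRatio α v N * (N + 1 - α) := by
  have h1 := poch_ne_zero (ne_neg_nat_of_re_pos (s := 1 - α + v) (by simp; linarith)) N
  have h2 : 1 - α + v + N ≠ 0 := fun h =>
    ne_neg_nat_of_re_pos (s := 1 - α + v) (by simp; linarith) N (eq_neg_of_add_eq_zero_left h)
  rw [betaRatio, betaRatio, poch_succ, poch_succ, mul_assoc, mul_assoc]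
  congr 1
  field_simp
  ring

lemma exists_betaRatio_bound {α v : ℂ} (hα : α.re < 1) (hv : 0 < v.re) :
    ∃ C, 0 ≤ C ∧ ∀ N : ℕ, ‖betaRatio α v N * (N : ℂ) ^ v‖ ≤ C ∧ ‖betaRatio α v N‖ ≤ C := by
  have h1 := (tendsto_betaRatio hα hv)
  have h2 := h1.mul (tendsto_nat_cpow_neg (x := -v) (by simpa using hv))
  have h3 : Tendsto (betaRatio α v) atTop (𝓝 (1 * 0)) := by
    refine h2.congr' ?_
    filter_upwards [eventually_gt_atTop 0] with n hn
    have hn' : (n : ℂ) ≠ 0 := by exact_mod_cast hn.ne'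
    rw [mul_assoc, ← Complex.cpow_add _ _ hn', add_neg_cancel, Complex.cpow_zero, mul_one]
  obtain ⟨C1, hC1⟩ := h1.norm.bddAbove_range
  obtain ⟨C2, hC2⟩ := h3.norm.bddAbove_range
  have hC1' := fun N => hC1 (Set.mem_range_self N)
  have hC2' := fun N => hC2 (Set.mem_range_self N)
  exact ⟨max C1 C2, (norm_nonneg _).trans ((hC1' 0).trans (le_max_left _ _)),
    fun N => ⟨(hC1' N).trans (le_max_left _ _), (hC2' N).trans (le_max_right _ _)⟩⟩

lemma summable_mellin {α v a b c : ℂ} (hα : α.re < 1) (hv : 0 < v.re) (hc : ∀ m : ℕ, c ≠ -m)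
    (h : 0 < (c - a - b).re) (M : ℕ) :
    Summable fun n => hypCoeff a b c n * betaRatio α v (n + M) := by
  obtain ⟨C, -, hC⟩ := exists_betaRatio_bound hα hv
  refine Summable.of_norm_bounded ((summable_norm_hypCoeff a b c hc h).mul_right C) fun n => ?_
  rw [norm_mul]
  exact mul_le_mul_of_nonneg_left (hC _).2 (norm_nonneg _)

lemma tendsto_ratio_cpow (M : ℕ) (x : ℂ) :
    Tendsto (fun n : ℕ => (n : ℂ) ^ x / ((n + M : ℕ) : ℂ) ^ x) atTop (𝓝 1) := by
  induction M with
  | zero =>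
    refine tendsto_const_nhds.congr' ?_
    filter_upwards [eventually_gt_atTop 0] with n hn
    have hn' : (n : ℂ) ≠ 0 := by exact_mod_cast hn.ne'
    rw [add_zero, div_self (by simp [Complex.cpow_eq_zero_iff, hn'])]
  | succ M ih =>
    have h := ih.mul (((tendsto_shift_cpow x).comp (tendsto_add_atTop_nat M)).inv₀ one_ne_zero)
    rw [inv_one, mul_one] at h
    refine h.congr' ?_
    filter_upwards [eventually_gt_atTop 0] with n hn
    have hn' : ((n + M : ℕ) : ℂ) ≠ 0 := by exact_mod_cast (by omega : n + M ≠ 0)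
    have h1 : ((n + M : ℕ) : ℂ) ^ x ≠ 0 := by simp only [ne_eq, Complex.cpow_eq_zero_iff, hn']; simp
    simp only [Function.comp]
    rw [inv_div, div_mul_div_cancel₀ h1, ← add_assoc, Nat.cast_succ]

/-- The difference equation of the Mellin transform. -/
lemma mellinSum_step {α β γ₁ γ₂ v : ℂ} (hV : α + β + γ₁ + γ₂ = v) (hα : α.re < 1)
    (hv : 0 < v.re) (hv1 : v.re < 1) (hc : ∀ m : ℕ, β - α + 1 ≠ -m) (M : ℕ) :
    ((M : ℂ) + 1 - α) * (M + 1 - β) * mellinSum α v (γ₁ + β) (γ₂ + β) (β - α + 1) M =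
      (M + 1 + γ₁) * (M + 1 + γ₂) * mellinSum α v (γ₁ + β) (γ₂ + β) (β - α + 1) (M + 1) -
      Complex.Gamma (β - α + 1) / (Complex.Gamma (γ₁ + β) * Complex.Gamma (γ₂ + β)) := by
  set a := γ₁ + β with ha
  set b := γ₂ + β with hb
  set c := β - α + 1 with hc'
  have hcab : c - a - b = 1 - v := by rw [ha, hb, hc', ← hV]; ring
  have hre : 0 < (c - a - b).re := by rw [hcab]; simp; linarith
  have hs := fun M => summable_mellin hα hv hc hre M
  have hcn : ∀ n : ℕ, c + n ≠ 0 := fun n h => hc n (eq_neg_of_add_eq_zero_left h)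
  -- The combination of terms is a difference of n(n+c-1) · `hypCoeff` · `betaRatio`, up to sign.
  -- That expression vanishes at n = 0 but not at infinity; its limit is the inhomogeneous term.
  have key := tsum_of_telescope (f := fun n => ((M : ℂ) + 1 - α) * (M + 1 - β) *
      (hypCoeff a b c n * betaRatio α v (n + M)) -
      (M + 1 + γ₁) * (M + 1 + γ₂) * (hypCoeff a b c n * betaRatio α v (n + (M + 1))))
    (g := fun n => -(n * (n + c - 1) * (hypCoeff a b c n * betaRatio α v (n + M))))
    (l := -(Complex.Gamma c / (Complex.Gamma a * Complex.Gamma b)))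
    (((hs M).mul_left _).sub ((hs (M + 1)).mul_left _)) (fun n => ?_) (Tendsto.neg ?_)
  · rw [Summable.tsum_sub ((hs M).mul_left _) ((hs (M + 1)).mul_left _), tsum_mul_left,
      tsum_mul_left] at key
    simp only [Nat.cast_zero, zero_mul, neg_zero, sub_zero] at key
    rw [mellinSum, mellinSum]
    linear_combination key
  · have hB := betaRatio_succ hα hv (n + M)
    have hx0 : ((n + M : ℕ) : ℂ) + 1 - α + v ≠ 0 := by
      intro h
      refine ne_neg_nat_of_re_pos (s := 1 - α + v) (by simp; linarith) (n + M) ?_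
      linear_combination h
    rw [show n + 1 + M = n + M + 1 by ring, ← add_assoc, hypCoeff_succ]
    have h5 : (1 : ℂ) + n ≠ 0 := by
      rw [add_comm]; exact_mod_cast Nat.succ_ne_zero n
    have h6 := hcn n
    have hB' : betaRatio α v (n + M + 1) =
        betaRatio α v (n + M) * (((n + M : ℕ) + 1 - α) / ((n + M : ℕ) + 1 - α + v)) := by
      rw [← mul_div_assoc, eq_div_iff hx0, hB]
    have h7 : c + n - 1 + 1 ≠ 0 := by rw [sub_add_cancel]; exact h6
    rw [hB']
    push_cast at hx0 ⊢
    have e : -(((n : ℂ) + 1) * (n + 1 + c - 1) * (hypCoeff a b c n * ((a + n) * (b + n) /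
        ((1 + n) * (c + n))) * (betaRatio α v (n + M) * ((n + M + 1 - α) / (n + M + 1 - α + v))))) =
        -((a + n) * (b + n) * (hypCoeff a b c n * (betaRatio α v (n + M) *
          ((n + M + 1 - α) / (n + M + 1 - α + v))))) := by
      field_simp
      ring
    rw [e]
    field_simp
    rw [ha, hb, hc', ← hV]
    ring
  -- The coefficients scale like n^(v-2) and the Beta values like n^(-v), exactly balancing the
  -- factor n².
  · have h1 := ((tendsto_hypCoeff a b c hc).mul
      ((tendsto_betaRatio hα hv).comp (tendsto_add_atTop_nat M))).mul (tendsto_ratio_cpow M v)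
    have h2 : Tendsto (fun n : ℕ => 1 + (c - 1) * (1 / (n : ℂ))) atTop (𝓝 (1 + (c - 1) * 0)) :=
      (tendsto_one_div_atTop_nhds_zero_nat.const_mul _).const_add _
    have h3 := h1.mul h2
    simp only [mul_one, mul_zero, add_zero] at h3
    refine h3.congr' ?_
    filter_upwards [eventually_gt_atTop 0] with n hn
    have hn' : (n : ℂ) ≠ 0 := by exact_mod_cast hn.ne'
    have hn2 : ((n + M : ℕ) : ℂ) ≠ 0 := by exact_mod_cast (by omega : n + M ≠ 0)
    have h4 : ((n + M : ℕ) : ℂ) ^ v ≠ 0 := by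
      simp only [ne_eq, Complex.cpow_eq_zero_iff, hn2]; simp
    have h5 : (n : ℂ) ^ (c - a - b + 1) * (n : ℂ) ^ v = n ^ 2 := by
      rw [← Complex.cpow_add _ _ hn', hcab, show 1 - v + 1 + v = ((2 : ℕ) : ℂ) by push_cast; ring,
        Complex.cpow_natCast]
    simp only [Function.comp]
    calc _ = hypCoeff a b c n * betaRatio α v (n + M) *
          ((n : ℂ) ^ (c - a - b + 1) * (n : ℂ) ^ v) * (1 + (c - 1) * (1 / (n : ℂ))) := by
          field_simp
      _ = _ := by rw [h5]; field_simp; ring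

/-- The leading asymptotics of the Mellin transform. -/
lemma tendsto_mellinSum {α v a b c : ℂ} (hα : α.re < 1) (hv : 0 < v.re) (hc : ∀ m : ℕ, c ≠ -m)
    (h : 0 < (c - a - b).re) :
    Tendsto (fun M : ℕ => mellinSum α v a b c M * (M : ℂ) ^ v) atTop
      (𝓝 (Complex.Gamma c * Complex.Gamma (c - a - b) /
        (Complex.Gamma (c - a) * Complex.Gamma (c - b)))) := by
  obtain ⟨C, hC0, hC⟩ := exists_betaRatio_bound hα hv
  -- Termwise, M^v `betaRatio α v (n + M)` → 1, bounded uniformly because |M^v| ≤ |(n+M)^v| for Re v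
  -- > 0. The limit is the hypergeometric series at 1.
  rw [← tsum_hypCoeff a b c hc h]
  simp_rw [mellinSum, ← tsum_mul_right]
  refine tendsto_tsum_of_dominated_convergence
    ((summable_norm_hypCoeff a b c hc h).mul_right C) (fun n => ?_) ?_
  · have h1 := (((tendsto_betaRatio hα hv).comp (tendsto_add_atTop_nat n)).mul
      (tendsto_ratio_cpow n v)).const_mul (hypCoeff a b c n)
    rw [mul_one, mul_one] at h1
    refine h1.congr' ?_
    filter_upwards [eventually_gt_atTop 0] with M hM
    have hn2 : ((M + n : ℕ) : ℂ) ≠ 0 := by exact_mod_cast (by omega : M + n ≠ 0)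
    have h4 : ((M + n : ℕ) : ℂ) ^ v ≠ 0 := by
      simp only [ne_eq, Complex.cpow_eq_zero_iff, hn2]; simp
    simp only [Function.comp]
    rw [add_comm n M]
    field_simp
  · filter_upwards [eventually_gt_atTop 0] with M hM n
    rw [mul_assoc, norm_mul]
    refine mul_le_mul_of_nonneg_left (le_trans ?_ (hC (n + M)).1) (norm_nonneg _)
    rw [norm_mul, norm_mul, Complex.norm_natCast_cpow_of_pos hM,
      Complex.norm_natCast_cpow_of_pos (by omega)]
    gcongr
    omega

/-! ### Reflection formula and the connection constants -/

/-- Valid at integers too, where one Gamma factor is 0 by convention and the sine vanishes. Hence no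
poles of the reciprocal Gamma factors need separate treatment. -/
lemma inv_Gamma_mul (z : ℂ) : (Complex.Gamma z * Complex.Gamma (1 - z))⁻¹ =
    Complex.sin (Real.pi * z) / Real.pi := by
  rw [Complex.Gamma_mul_Gamma_one_sub, inv_div]

lemma sin_ne_zero_of_not_int {c : ℂ} (hc : ∀ m : ℤ, c ≠ m) : Complex.sin (Real.pi * c) ≠ 0 := by
  rw [Complex.sin_ne_zero_iff]
  intro k h
  have hpi : (Real.pi : ℂ) ≠ 0 := by exact_mod_cast Real.pi_ne_zero
  exact hc k (mul_left_cancel₀ hpi (by rw [h, mul_comm]))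

lemma sin_pi_sub_one (c : ℂ) :
    Complex.sin (Real.pi * (c - 1)) = -Complex.sin (Real.pi * c) := by
  rw [mul_sub, mul_one, Complex.sin_sub_pi]

/-- The combined inhomogeneity of the two difference equations. Reflection turns every Gamma pair
into a sine, and the claim becomes sin x sin y - sin(z-x) sin(z-y) = sin z sin(x+y-z). -/
lemma connection_const {a b c v : ℂ} (hc : ∀ m : ℤ, c ≠ m) (hv : c - a - b = 1 - v) :
    Complex.Gamma (1 - c) / (Complex.Gamma (1 - a) * Complex.Gamma (1 - b)) *
      (Complex.Gamma c / (Complex.Gamma a * Complex.Gamma b)) +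
    Complex.Gamma (c - 1) / (Complex.Gamma (c - a) * Complex.Gamma (c - b)) *
      (Complex.Gamma (1 - (c - 1)) /
        (Complex.Gamma (1 - (c - a)) * Complex.Gamma (1 - (c - b)))) =
    -(Complex.sin (Real.pi * v) / Real.pi) := by
  have hs := sin_ne_zero_of_not_int hc
  have hpi : (Real.pi : ℂ) ≠ 0 := by exact_mod_cast Real.pi_ne_zero
  have e1 : Complex.Gamma (1 - c) / (Complex.Gamma (1 - a) * Complex.Gamma (1 - b)) *
      (Complex.Gamma c / (Complex.Gamma a * Complex.Gamma b)) =
      (Complex.Gamma c * Complex.Gamma (1 - c)) * ((Complex.Gamma a * Complex.Gamma (1 - a))⁻¹ *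
        (Complex.Gamma b * Complex.Gamma (1 - b))⁻¹) := by
    rw [← mul_inv]; ring
  have e2 : Complex.Gamma (c - 1) / (Complex.Gamma (c - a) * Complex.Gamma (c - b)) *
      (Complex.Gamma (1 - (c - 1)) /
        (Complex.Gamma (1 - (c - a)) * Complex.Gamma (1 - (c - b)))) =
      (Complex.Gamma (c - 1) * Complex.Gamma (1 - (c - 1))) *
        ((Complex.Gamma (c - a) * Complex.Gamma (1 - (c - a)))⁻¹ *
        (Complex.Gamma (c - b) * Complex.Gamma (1 - (c - b)))⁻¹) := by
    rw [← mul_inv]; ring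
  rw [e1, e2, inv_Gamma_mul, inv_Gamma_mul, inv_Gamma_mul, inv_Gamma_mul,
    Complex.Gamma_mul_Gamma_one_sub, Complex.Gamma_mul_Gamma_one_sub, sin_pi_sub_one]
  have hv' : v = a + b - c + 1 := by linear_combination hv
  have e3 : Complex.sin (Real.pi * v) = -Complex.sin (Real.pi * a + Real.pi * b - Real.pi * c) := by
    rw [hv', show (Real.pi : ℂ) * (a + b - c + 1) =
      (Real.pi * a + Real.pi * b - Real.pi * c) + Real.pi by ring, Complex.sin_add_pi]
  rw [e3, mul_sub, mul_sub]
  generalize (Real.pi : ℂ) * a = x at *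
  generalize (Real.pi : ℂ) * b = y at *
  generalize (Real.pi : ℂ) * c = z at *
  have e4 : Complex.sin x * Complex.sin y - Complex.sin (z - x) * Complex.sin (z - y) =
      Complex.sin z * Complex.sin (x + y - z) := by
    simp only [Complex.sin_sub, Complex.sin_add, Complex.cos_add]
    linear_combination (-Complex.sin x * Complex.sin y) * Complex.sin_sq_add_cos_sq z
  field_simp
  linear_combination e4

/-- The M^(-v) terms of the two Mellin sums cancel because Γ(c)Γ(1-c) changes sign under c → c - 1.
-/
lemma connection_vanish {a b c v : ℂ} :
    Complex.Gamma (1 - c) / (Complex.Gamma (1 - a) * Complex.Gamma (1 - b)) *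
      (Complex.Gamma c * Complex.Gamma (1 - v) / (Complex.Gamma (c - a) * Complex.Gamma (c - b))) +
    Complex.Gamma (c - 1) / (Complex.Gamma (c - a) * Complex.Gamma (c - b)) *
      (Complex.Gamma (1 - (c - 1)) * Complex.Gamma (1 - v) /
        (Complex.Gamma (1 - a) * Complex.Gamma (1 - b))) = 0 := by
  have h1 := Complex.Gamma_mul_Gamma_one_sub c
  have h2 := Complex.Gamma_mul_Gamma_one_sub (c - 1)
  rw [sin_pi_sub_one, div_neg] at h2
  linear_combination (Complex.Gamma (1 - v) * (Complex.Gamma (1 - a))⁻¹ * (Complex.Gamma (1 - b))⁻¹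
    * (Complex.Gamma (c - a))⁻¹ * (Complex.Gamma (c - b))⁻¹) * (h1 + h2)

/-! ### Telescoping the hypergeometric series -/

/-- The two Mellin transforms combine to the hypergeometric form of the generating function. -/
theorem tsum_prodTerm_eq {α β γ₁ γ₂ v : ℂ} (hV : α + β + γ₁ + γ₂ = v) (hα : α.re < 1)
    (hβ : β.re < 1) (hv : 0 < v.re) (hv1 : v.re < 1) (hint : ∀ m : ℤ, α - β ≠ m) :
    ∑' m, prodTerm α β γ₁ γ₂ m =
      Complex.Gamma v * Complex.Gamma (1 - v) *
      (Complex.Gamma (α - β) / (Complex.Gamma (1 - γ₁ - β) * Complex.Gamma (1 - γ₂ - β)) *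
        mellinSum α v (γ₁ + β) (γ₂ + β) (β - α + 1) 0 +
      Complex.Gamma (β - α) / (Complex.Gamma (1 - γ₁ - α) * Complex.Gamma (1 - γ₂ - α)) *
        mellinSum β v (γ₁ + α) (γ₂ + α) (α - β + 1) 0) := by
  set a := γ₁ + β with ha
  set b := γ₂ + β with hb
  set c := β - α + 1 with hc
  have hcab : c - a - b = 1 - v := by rw [ha, hb, hc, ← hV]; ring
  have hcab' : (α - β + 1) - (γ₁ + α) - (γ₂ + α) = 1 - v := by rw [← hV]; ring
  have hre : 0 < (1 - v).re := by simp; linarith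
  have hcint : ∀ m : ℤ, c ≠ m := fun m h => hint (1 - m) (by
    push_cast; linear_combination -h + hc)
  have hcn : ∀ m : ℕ, β - α + 1 ≠ -m := fun m h => hint (1 + m) (by
    push_cast; linear_combination -h)
  have hcn' : ∀ m : ℕ, α - β + 1 ≠ -m := fun m h => hint (-1 - m) (by
    push_cast; linear_combination h)
  have r1 : α - β = 1 - c := by rw [hc]; ring
  have r2 : β - α = c - 1 := by rw [hc]; ring
  have r3 : 1 - γ₁ - β = 1 - a := by rw [ha]; ring
  have r4 : 1 - γ₂ - β = 1 - b := by rw [hb]; ring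
  have r5 : 1 - γ₁ - α = c - a := by rw [ha, hc]; ring
  have r6 : 1 - γ₂ - α = c - b := by rw [hb, hc]; ring
  set A := Complex.Gamma (α - β) / (Complex.Gamma (1 - γ₁ - β) * Complex.Gamma (1 - γ₂ - β)) with hA
  set B := Complex.Gamma (β - α) / (Complex.Gamma (1 - γ₁ - α) * Complex.Gamma (1 - γ₂ - α)) with hB
  have s1 := fun M => mellinSum_step hV hα hv hv1 hcn M
  have s2 := fun M => mellinSum_step (by rw [← hV]; ring : β + α + γ₁ + γ₂ = v) hβ hv hv1 hcn' M
  have l1 := tendsto_mellinSum (a := a) (b := b) hα hv hcn (by rw [← hc, hcab]; exact hre)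
  have l2 := tendsto_mellinSum (a := γ₁ + α) (b := γ₂ + α) hβ hv hcn' (by rw [hcab']; exact hre)
  set m1 := mellinSum α v a b c with hm1
  set m2 := mellinSum β v (γ₁ + α) (γ₂ + α) (α - β + 1) with hm2
  have hK := connection_const hcint hcab
  have hL := connection_vanish (a := a) (b := b) (c := c) (v := v)
  have q1 : α - β + 1 = 1 - (c - 1) := by rw [hc]; ring
  have q2 : γ₁ + α = 1 - (c - a) := by rw [ha, hc]; ring
  have q3 : γ₂ + α = 1 - (c - b) := by rw [hb, hc]; ring
  have q4 : α - β + 1 - (γ₁ + α) = 1 - a := by rw [ha]; ring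
  have q5 : α - β + 1 - (γ₂ + α) = 1 - b := by rw [hb]; ring
  rw [← hc, hcab] at l1
  rw [hcab', q4, q5, q1] at l2
  rw [r1, r3, r4] at hA
  rw [r2, r5, r6] at hB
  rw [← hA, ← hB] at hK hL
  have hsin : Complex.sin (Real.pi * v) ≠ 0 := by
    refine sin_ne_zero_of_not_int fun m h => ?_
    rw [h, Complex.intCast_re] at hv hv1
    have h1 : (0 : ℤ) < m := by exact_mod_cast hv
    have h2 : m < (1 : ℤ) := by exact_mod_cast hv1
    omega
  have hpi : (Real.pi : ℂ) ≠ 0 := by exact_mod_cast Real.pi_ne_zero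
  -- R_M T_M will be the tail of the series from M on. The prefactor Γ(v)Γ(1-v) = π/sin(πv) cancels
  -- the constant from `connection_const`.
  set T : ℕ → ℂ := fun M => Complex.Gamma v * Complex.Gamma (1 - v) * (A * m1 M + B * m2 M) with hT
  have hstep : ∀ M : ℕ, ((M : ℂ) + 1 - α) * (M + 1 - β) * T M =
      (M + 1 + γ₁) * (M + 1 + γ₂) * T (M + 1) + 1 := by
    intro M
    have h1 := s1 M
    have h2 := s2 M
    rw [← q1, ← q2, ← q3] at hK
    have h3 : Complex.Gamma v * Complex.Gamma (1 - v) * (Complex.sin (Real.pi * v) / Real.pi) = 1 := by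
      rw [Complex.Gamma_mul_Gamma_one_sub]; field_simp
    simp only [hT]
    linear_combination (Complex.Gamma v * Complex.Gamma (1 - v)) * (A * h1 + B * h2 - hK) + h3
  -- The recurrence fixes T only up to homogeneous solutions, multiples of 1/R_M. This decay, faster
  -- than M^(-v), excludes them.
  have hlim : Tendsto (fun M : ℕ => T M * (M : ℂ) ^ v) atTop (𝓝 0) := by
    have h := ((l1.const_mul A).add (l2.const_mul B)).const_mul
      (Complex.Gamma v * Complex.Gamma (1 - v))
    rw [hL, mul_zero] at h
    refine h.congr fun M => ?_
    simp only [hT]; ring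
  have hnα : ∀ m : ℕ, 1 - α ≠ -m := ne_neg_nat_of_re_pos (by simp; linarith)
  have hnβ : ∀ m : ℕ, 1 - β ≠ -m := ne_neg_nat_of_re_pos (by simp; linarith)
  set R : ℕ → ℂ := fun m => ∏ l ∈ range m, ((l : ℂ) + 1 + γ₁) * (l + 1 + γ₂) /
    ((l + 1 - α) * (l + 1 - β)) with hR
  have hpartial : ∀ N : ℕ, ∑ m ∈ range N, prodTerm α β γ₁ γ₂ m = T 0 - R N * T N := by
    intro N
    induction N with
    | zero => simp [hR]
    | succ N ih =>
      have h1 : (N : ℂ) + 1 - α ≠ 0 := fun h => hnα N (by linear_combination h)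
      have h2 : (N : ℂ) + 1 - β ≠ 0 := fun h => hnβ N (by linear_combination h)
      have h3 : prodTerm α β γ₁ γ₂ N = R N * (1 / (((N : ℂ) + 1 - α) * (N + 1 - β))) := rfl
      have h4 : R (N + 1) = R N * (((N : ℂ) + 1 + γ₁) * (N + 1 + γ₂) /
        ((N + 1 - α) * (N + 1 - β))) := prod_range_succ _ _
      have h5 : T N = (((N : ℂ) + 1 + γ₁) * (N + 1 + γ₂) * T (N + 1) + 1) /
          ((N + 1 - α) * (N + 1 - β)) := by
        rw [← hstep, mul_div_cancel_left₀ _ (mul_ne_zero h1 h2)]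
      rw [sum_range_succ, ih, h3, h4, h5]
      field_simp
      ring
  -- R_N N^(-v) converges, since γ₁ + α + γ₂ + β = v, and T_N N^v tends to 0.
  have hRT : Tendsto (fun N => R N * T N) atTop (𝓝 0) := by
    have h := ((tendsto_poch_div (1 + γ₁) (1 - α) hnα).mul
      (tendsto_poch_div (1 + γ₂) (1 - β) hnβ)).mul hlim
    rw [mul_zero] at h
    refine h.congr' ?_
    filter_upwards [eventually_gt_atTop 0] with n hn
    have hn' : (n : ℂ) ≠ 0 := by exact_mod_cast hn.ne'
    have h1 : (n : ℂ) ^ (1 - α - (1 + γ₁)) * (n : ℂ) ^ (1 - β - (1 + γ₂)) * (n : ℂ) ^ v = 1 := by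
      rw [← Complex.cpow_add _ _ hn', ← Complex.cpow_add _ _ hn',
        show 1 - α - (1 + γ₁) + (1 - β - (1 + γ₂)) + v = 0 by rw [← hV]; ring, Complex.cpow_zero]
    have h2 : R n = poch (1 + γ₁) n / poch (1 - α) n * (poch (1 + γ₂) n / poch (1 - β) n) := by
      simp only [hR, poch]
      rw [← prod_div_distrib, ← prod_div_distrib, ← prod_mul_distrib]
      refine prod_congr rfl fun l _ => ?_
      rw [div_mul_div_comm]
      congr 1 <;> ring
    rw [h2]
    linear_combination (poch (1 + γ₁) n / poch (1 - α) n * (poch (1 + γ₂) n / poch (1 - β) n) *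
      T n) * h1
  have hsum := (summable_prodTerm hα hβ (by rw [hV]; exact hv1)).hasSum.tendsto_sum_nat
  simp_rw [hpartial] at hsum
  have := tendsto_nhds_unique hsum (hRT.const_sub (T 0))
  rw [this, sub_zero]

/-! ### The Euler-type integrals -/

lemma hypergeometric_eq_tsum (a b c z : ℂ) : ₂F₁ a b c z = ∑' n : ℕ, hypCoeff a b c n * z ^ n := by
  rw [ordinaryHypergeometric_eq_tsum]
  refine tsum_congr fun n => ?_
  rw [smul_eq_mul, hypCoeff, poch_one, poch_eq_eval, poch_eq_eval, poch_eq_eval]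
  field_simp

section EulerIntegral

variable {δ v a b c : ℂ}

lemma intervalIntegrable_beta (hδ : δ.re < 1) (hv : 0 < v.re) :
    IntervalIntegrable (fun z : ℝ => (z : ℂ) ^ (-δ) * (1 - (z : ℂ)) ^ (v - 1)) volume 0 1 := by
  have h := Complex.betaIntegral_convergent (u := 1 - δ) (v := v) (by simp; linarith) hv
  rwa [show 1 - δ - 1 = -δ by ring] at h

lemma intervalIntegrable_eulerIntegrand (hδ : δ.re < 1) (hv : 0 < v.re) (hc : ∀ m : ℕ, c ≠ -m)
    (h : 0 < (c - a - b).re) :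
    IntervalIntegrable (eulerIntegrand δ v a b c) volume 0 1 := by
  -- Re(c-a-b) > 0 makes the coefficients absolutely summable, so F is continuous on all of [0, 1];
  -- only the Beta kernel is singular.
  refine (intervalIntegrable_beta hδ hv).mul_continuousOn ?_
  simp_rw [hypergeometric_eq_tsum]
  refine continuousOn_tsum (fun n => by fun_prop) (summable_norm_hypCoeff a b c hc h)
    (fun n z hz => ?_)
  rw [Set.uIcc_of_le zero_le_one] at hz
  rw [norm_mul, norm_pow, Complex.norm_real, Real.norm_of_nonneg hz.1]
  exact mul_le_of_le_one_right (norm_nonneg _) (pow_le_one₀ hz.1 hz.2)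

/-- Termwise integration, dominated by the Beta kernel times the coefficients; z^n shifts the first
Beta parameter to 1 - δ + n. -/
lemma integral_eulerIntegrand (hδ : δ.re < 1) (hv : 0 < v.re) (hc : ∀ m : ℕ, c ≠ -m)
    (h : 0 < (c - a - b).re) :
    ∫ z in (0 : ℝ)..1, eulerIntegrand δ v a b c z =
      Complex.Gamma v * mellinSum δ v a b c 0 := by
  set μ := volume.restrict (Set.Ioc (0 : ℝ) 1) with hμ
  set k : ℝ → ℂ := fun z => (z : ℂ) ^ (-δ) * (1 - (z : ℂ)) ^ (v - 1) with hk
  have hkint : Integrable k μ :=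
    (intervalIntegrable_iff_integrableOn_Ioc_of_le zero_le_one).1 (intervalIntegrable_beta hδ hv)
  set f : ℕ → ℝ → ℂ := fun n z => hypCoeff a b c n * (k z * (z : ℂ) ^ n) with hf
  have hle : ∀ n : ℕ, ∀ᵐ z ∂μ, ‖k z * (z : ℂ) ^ n‖ ≤ ‖k z‖ := fun n => by
    refine (ae_restrict_iff' measurableSet_Ioc).2 (Eventually.of_forall fun z hz => ?_)
    rw [norm_mul, norm_pow, Complex.norm_real, Real.norm_of_nonneg hz.1.le]
    exact mul_le_of_le_one_right (norm_nonneg _) (pow_le_one₀ hz.1.le hz.2)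
  have hkn : ∀ n : ℕ, Integrable (fun z => k z * (z : ℂ) ^ n) μ := fun n =>
    hkint.mono (hkint.aestronglyMeasurable.mul (by fun_prop)) (hle n)
  have hfi : ∀ n, Integrable (f n) μ := fun n => (hkn n).const_mul _
  have hfs : Summable fun n => ∫ z, ‖f n z‖ ∂μ := by
    refine Summable.of_nonneg_of_le (fun n => integral_nonneg fun _ => norm_nonneg _) (fun n => ?_)
      ((summable_norm_hypCoeff a b c hc h).mul_right (∫ z, ‖k z‖ ∂μ))
    simp only [hf, norm_mul (hypCoeff a b c n)]
    rw [integral_const_mul]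
    exact mul_le_mul_of_nonneg_left (integral_mono_ae (hkn n).norm hkint.norm (hle n))
      (norm_nonneg _)
  have hsum := hasSum_integral_of_summable_integral_norm hfi hfs
  rw [intervalIntegral.integral_of_le zero_le_one]
  have e1 : ∀ z, eulerIntegrand δ v a b c z = ∑' n, f n z := by
    intro z
    rw [eulerIntegrand, hypergeometric_eq_tsum, ← tsum_mul_left]
    exact tsum_congr fun n => by simp only [hf, hk]; ring
  simp_rw [e1]
  rw [← hsum.tsum_eq, mellinSum, ← tsum_mul_left]
  refine tsum_congr fun n => ?_
  have hn : ∀ m : ℕ, 1 - δ ≠ -m := ne_neg_nat_of_re_pos (by simp; linarith)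
  have hn' : ∀ m : ℕ, 1 - δ + v ≠ -m := ne_neg_nat_of_re_pos (by simp; linarith)
  have hre : 0 < ((1 - δ) + n).re := by
    simp; linarith [Nat.cast_nonneg (α := ℝ) n]
  have e2 : ∫ z, k z * (z : ℂ) ^ n ∂μ = Complex.betaIntegral ((1 - δ) + n) v := by
    rw [Complex.betaIntegral, intervalIntegral.integral_of_le zero_le_one]
    refine setIntegral_congr_fun measurableSet_Ioc fun z hz => ?_
    have hz0 : (z : ℂ) ≠ 0 := by exact_mod_cast hz.1.ne'
    simp only [hk]
    rw [show 1 - δ + (n : ℂ) - 1 = -δ + n by ring, Complex.cpow_add _ _ hz0, Complex.cpow_natCast]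
    ring
  have hB := Complex.Gamma_mul_Gamma_eq_betaIntegral hre hv
  rw [show 1 - δ + (n : ℂ) + v = (1 - δ + v) + n by ring, Gamma_add_nat hn, Gamma_add_nat hn'] at hB
  have h1 := poch_ne_zero hn' n
  have h2 := Complex.Gamma_ne_zero hn'
  simp only [hf]
  rw [integral_const_mul, e2, betaRatio, add_zero]
  field_simp
  linear_combination (-hypCoeff a b c n) * hB

end EulerIntegral

end InterpolatedMZV

/-! ### The main theorem -/

theorem mainTheorem10 (t : ℂ) :
    (∃ r : ℝ, 0 < r ∧ ∀ u v w : ℂ, ‖u‖ < r → ‖v‖ < r → ‖w‖ < r →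
      Summable (InterpolatedMZV.Φ₀Term t u v w)) ∧
    ∀ u v w α β γ₁ γ₂ : ℂ,
      α + β = u + v * t → α * β = t * (u * v - w ^ 2) →
      γ₁ + γ₂ = -u - (t - 1) * v → γ₁ * γ₂ = (t - 1) * (u * v - w ^ 2) →
      α.re < 1 → β.re < 1 → 0 < v.re → v.re < 1 →
      (∀ m : ℤ, α - β ≠ m) →
      IntervalIntegrable
          (InterpolatedMZV.eulerIntegrand α v (γ₁ + β) (γ₂ + β) (β - α + 1))
          MeasureTheory.volume 0 1 ∧
        IntervalIntegrable
          (InterpolatedMZV.eulerIntegrand β v (γ₁ + α) (γ₂ + α) (α - β + 1))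
          MeasureTheory.volume 0 1 ∧
        (Summable (InterpolatedMZV.Φ₀Term t u v w) →
          InterpolatedMZV.Φ₀ t u v w =
            Complex.Gamma (α - β) * Complex.Gamma (1 - v) /
                (Complex.Gamma (1 - γ₁ - β) * Complex.Gamma (1 - γ₂ - β)) *
              (∫ z in (0 : ℝ)..1,
                InterpolatedMZV.eulerIntegrand α v (γ₁ + β) (γ₂ + β) (β - α + 1) z) +
            Complex.Gamma (β - α) * Complex.Gamma (1 - v) /
                (Complex.Gamma (1 - γ₁ - α) * Complex.Gamma (1 - γ₂ - α)) *
              (∫ z in (0 : ℝ)..1,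
                InterpolatedMZV.eulerIntegrand β v (γ₁ + α) (γ₂ + α) (α - β + 1) z)) := by
  refine ⟨?_, ?_⟩
  · obtain ⟨r, hr, h⟩ := InterpolatedMZV.exists_radius t
    refine ⟨r, hr, fun u v w hu hv hw => ?_⟩
    obtain ⟨h1, h2, h3⟩ := h u v w hu hv hw
    exact (InterpolatedMZV.hasSum_Φ₀Term_genSum t u v w h1 h2 h3).summable
  · intro u v w α β γ₁ γ₂ p1 p2 p3 p4 hα hβ hv hv1 hint
    have hp : InterpolatedMZV.IsParam t u v w α β γ₁ γ₂ := ⟨p1, p2, p3, p4⟩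
    have hV := hp.sum_eq
    have hcn : ∀ m : ℕ, β - α + 1 ≠ -m := fun m h => hint (1 + m) (by
      push_cast; linear_combination -h)
    have hcn' : ∀ m : ℕ, α - β + 1 ≠ -m := fun m h => hint (-1 - m) (by
      push_cast; linear_combination h)
    have hre : 0 < ((β - α + 1) - (γ₁ + β) - (γ₂ + β)).re := by
      rw [show (β - α + 1) - (γ₁ + β) - (γ₂ + β) = 1 - v by rw [← hV]; ring]
      simp; linarith
    have hre' : 0 < ((α - β + 1) - (γ₁ + α) - (γ₂ + α)).re := by
      rw [show (α - β + 1) - (γ₁ + α) - (γ₂ + α) = 1 - v by rw [← hV]; ring]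
      simp; linarith
    refine ⟨InterpolatedMZV.intervalIntegrable_eulerIntegrand hα hv hcn hre,
      InterpolatedMZV.intervalIntegrable_eulerIntegrand hβ hv hcn' hre', fun hs => ?_⟩
    rw [InterpolatedMZV.tsum_Φ₀Term_eq hp hα hβ hv1 hs,
      InterpolatedMZV.tsum_prodTerm_eq hV hα hβ hv hv1 hint,
      InterpolatedMZV.integral_eulerIntegrand hα hv hcn hre,
      InterpolatedMZV.integral_eulerIntegrand hβ hv hcn' hre']
    ring
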